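/- **Setting.** Let $R=(0,W)\times(0,H)$ with $W,H>0$, let $\varepsilon>0$, $\lambda\ge 0$, and let $\eta\in C_c^\infty(\mathbb R^2)$ be a mollifier ($\eta\ge 0$, $\int\eta=1$, $\operatorname{supp}\eta\subset \overline{B(0,1)}$), $\eta_\varepsilon(x)=\varepsilon^{-2}\eta(x/\varepsilon)$. For $i=1,\dots,n$, the module of area $a>0$ is the rectangle $M_i(a)=[-\tfrac{w_i(a)}2,\tfrac{w_i(a)}2]\times[-\tfrac{h_i(a)}2,\tfrac{h_i(a)}2]$, where $w_i,h_i:(0,\infty)\to(0,\infty)$ are $C^2$ and $w_i(a)h_i(a)=a$ (for example, a fixed aspect ratio). For centres $c=(c_1,\dots,c_n)\in\mathbb R^{2n}$ and areas $A=(A_1,\dots,A_n)\in(0,\infty)^n$ put $$\rho_\varepsilon(x;c,A)=\sum_{i=1}^n(\eta_\varepsilon*\mathbf 1_{M_i(A_i)})(x-c_i),\qquad \bar\rho=\frac1{|R|}\sum_{i=1}^nA_i,\qquad E_\varepsilon(c,A)=\frac12\int_R|\nabla\phi_\varepsilon|^2\,dx,$$ where $\phi_\varepsilon$ is the weak solution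 of $-\Delta\phi_\varepsilon=\rho_\varepsilon-\bar\rho$ in $R$, $\partial_n\phi_\varepsilon=0$ on $\partial R$, $\int_R\phi_\varepsilon=0$; that is, $\phi_\varepsilon\in H^1(R)$ has mean zero and $\int_R\nabla\phi_\varepsilon\cdot\nabla v\,dx=\int_R(\rho_\varepsilon-\bar\rho)v\,dx$ for all $v\in H^1(R)$ of mean zero. Let the smoothed wirelength $\mathcal W(c,A)$ be any $C^2$ function on $\mathbb R^{2n}\times(0,\infty)^n$, and let $$F_{\varepsilon,\lambda}(c,A)=\mathcal W(c,A)+\lambda E_\varepsilon(c,A).$$ The feasible set $\mathcal C_R(A)$ consists of all $c$ with $c_i=(x_i,y_i)$, $\tfrac{w_i(A_i)}2\le x_i\le W-\tfrac{w_i(A_i)}2$ and $\tfrac{h_i(A_i)}2\le y_i\le H-\tfrac{h_i(A_i)}2$ for all $i$. **Theorem (Solution Stability).** Let $A^0\in(0,\infty)^n$ and let $c^0$ be a local minimizer of $F_{\varepsilon,\lambda}(\cdot,A^0)$ on $\mathcal C_R(A^0)$ such that 1. (regularity) the gradients at $c^0$ of the constraints active at $c^0$ are linearly independent; 2. (second-order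 sufficiency, in its strong form) $\langle\nabla^2_{cc}F_{\varepsilon,\lambda}(c^0,A^0)d,d\rangle>0$ for every $d\ne0$ in the linear span of the critical cone at $c^0$, which is the set of directions $d$ with $\nabla g(c^0)\cdot d\le0$ for all active constraints $g\le0$ and $\nabla_cF_{\varepsilon,\lambda}(c^0,A^0)\cdot d=0$. (Under strict complementarity, in particular if $c^0$ is an interior point, the critical cone is itself a linear space and this is the usual second-order sufficiency condition.) Then there are an open neighbourhood $U\subset(0,\infty)^n$ of $A^0$, an open neighbourhood $V$ of $c^0$ and a Lipschitz continuous map $c^*:U\to V$ with $c^*(A^0)=c^0$ such that for every $A\in U$, $c^*(A)$ is the unique local minimizer of $F_{\varepsilon,\lambda}(\cdot,A)$ on $\mathcal C_R(A)$ that lies in $V$. -/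

import Mathlib

open MeasureTheory Set Filter Topology
open scoped ContDiff

noncomputable section

namespace PeF

/-- The Euclidean plane. -/
abbrev Plane := EuclideanSpace ℝ (Fin 2)

/-- A placement: the vector `c = (c₁, …, cₙ)` of module centres. -/
abbrev Config (n : ℕ) := Fin n → Plane

/-! ### The Neumann problem and the Poisson energy -/

/-- `g` is the weak gradient of `v` on the open set `R`. -/
def IsWeakGradient (R : Set Plane) (v : Plane → ℝ) (g : Plane → Plane) : Prop :=
  ∀ ζ : Plane → ℝ, ContDiff ℝ ∞ ζ → HasCompactSupport ζ → tsupport ζ ⊆ R → ∀ k : Fin 2,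
    ∫ x in R, v x * fderiv ℝ ζ x (EuclideanSpace.single k 1) = -∫ x in R, g x k * ζ x

/-- `v ∈ H¹(R)` with weak gradient `g`. -/
structure IsH1 (R : Set Plane) (v : Plane → ℝ) (g : Plane → Plane) : Prop where
  memLp : MemLp v 2 (volume.restrict R)
  memLp_grad : MemLp g 2 (volume.restrict R)
  weakGradient : IsWeakGradient R v g

/-- `φ`, with weak gradient `g`, is the weak solution in `H¹(R)/ℝ` of the Neumann problem
`-Δφ = f` in `R`, `∂φ/∂n = 0` on `∂R`, `∫_R φ = 0`. The quotient `H¹(R)/ℝ` is realised by the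
functions of mean zero, both for the solution and for the test functions. -/
structure IsNeumannSolution (R : Set Plane) (f φ : Plane → ℝ) (g : Plane → Plane) : Prop where
  isH1 : IsH1 R φ g
  mean_zero : ∫ x in R, φ x = 0
  weak_eq : ∀ (v : Plane → ℝ) (gv : Plane → Plane), IsH1 R v gv → ∫ x in R, v x = 0 →
    ∫ x in R, inner ℝ (g x) (gv x) = ∫ x in R, f x * v x

open Classical in
/-- The Poisson energy `½ ∫_R |∇φ|²` of the source `f`, where `φ` is the weak solution of the
Neumann problem. It does not depend on the representative of `φ`; the value `0` is taken only
when there is no weak solution, which does not occur for a rectangle `R` and `f ∈ L²(R)`. -/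
def poissonEnergy (R : Set Plane) (f : Plane → ℝ) : ℝ :=
  if h : ∃ p : (Plane → ℝ) × (Plane → Plane), IsNeumannSolution R f p.1 p.2 then
    (1 / 2) * ∫ x in R, ‖h.choose.2 x‖ ^ 2
  else 0

/-! ### Mollified modules -/

/-- A mollifier on the plane: smooth, non-negative, of unit mass, supported in the unit disk. -/
structure IsMollifier (η : Plane → ℝ) : Prop where
  smooth : ContDiff ℝ ∞ η
  nonneg : ∀ x, 0 ≤ η x
  integral_eq_one : ∫ x, η x = 1
  support_subset : tsupport η ⊆ Metric.closedBall 0 1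

/-- The scaled mollifier `η_ε(x) = ε⁻² η(x / ε)`. -/
def scaledMollifier (η : Plane → ℝ) (ε : ℝ) (x : Plane) : ℝ :=
  (1 / ε ^ 2) * η (ε⁻¹ • x)

/-- The rectangle of width `w` and height `h` centred at the origin. -/
def centeredRect (w h : ℝ) : Set Plane :=
  {x | |x 0| ≤ w / 2 ∧ |x 1| ≤ h / 2}

/-- The mollified indicator `η_ε * 1_M`. -/
def mollifiedIndicator (η : Plane → ℝ) (ε : ℝ) (M : Set Plane) (x : Plane) : ℝ :=
  ∫ y, scaledMollifier η ε (x - y) * M.indicator (fun _ => (1 : ℝ)) y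

/-! ### The mollified floorplanning problem -/

/-- The data of a mollified fixed-outline floorplanning problem with `n` rectangular modules whose
areas are parameters. -/
structure Problem (n : ℕ) where
  /-- the dimensions of the outline `[0, W] × [0, H]` -/
  W : ℝ
  H : ℝ
  W_pos : 0 < W
  H_pos : 0 < H
  /-- the penalty weight -/
  lam : ℝ
  lam_nonneg : 0 ≤ lam
  /-- the mollifier and its radius -/
  η : Plane → ℝ
  isMollifier : IsMollifier η
  ε : ℝ
  ε_pos : 0 < ε
  /-- the width and the height of the `i`-th module, as functions of its area -/
  w : Fin n → ℝ → ℝ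
  h : Fin n → ℝ → ℝ
  w_pos : ∀ i a, 0 < a → 0 < w i a
  h_pos : ∀ i a, 0 < a → 0 < h i a
  area_eq : ∀ i a, 0 < a → w i a * h i a = a
  w_smooth : ∀ i, ContDiffOn ℝ 2 (w i) (Ioi 0)
  h_smooth : ∀ i, ContDiffOn ℝ 2 (h i) (Ioi 0)
  /-- the smoothed wirelength, an arbitrary `C²` function of the centres and the areas -/
  wirelength : Config n → (Fin n → ℝ) → ℝ
  wirelength_smooth : ContDiffOn ℝ 2 (fun p : Config n × (Fin n → ℝ) => wirelength p.1 p.2)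
    (univ ×ˢ {A | ∀ i, 0 < A i})

namespace Problem

variable {n : ℕ} (P : Problem n)

/-- The floorplanning region `R` (as an open rectangle). -/
def region : Set Plane := {x | (0 < x 0 ∧ x 0 < P.W) ∧ (0 < x 1 ∧ x 1 < P.H)}

/-- The mollified density `ρ_ε(x; c) = ∑ᵢ ψᵢ^ε(x - cᵢ)` for the module areas `A`. -/
def density (c : Config n) (A : Fin n → ℝ) (x : Plane) : ℝ :=
  ∑ i, mollifiedIndicator P.η P.ε (centeredRect (P.w i (A i)) (P.h i (A i))) (x - c i)

/-- The average density `(∑ᵢ Aᵢ) / |R|`. -/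
def meanDensity (A : Fin n → ℝ) : ℝ := (∑ i, A i) / (P.W * P.H)

/-- The mollified Poisson energy `E_ε(c, A)`. -/
def energy (c : Config n) (A : Fin n → ℝ) : ℝ :=
  poissonEnergy P.region (fun x => P.density c A x - P.meanDensity A)

/-- The objective `F_{ε,λ}(c, A) = W(c, A) + λ E_ε(c, A)`. -/
def objective (c : Config n) (A : Fin n → ℝ) : ℝ :=
  P.wirelength c A + P.lam * P.energy c A

/-- The dimensions of the outline. -/
def outline : Fin 2 → ℝ := ![P.W, P.H]

/-- The dimensions of the `i`-th module for the module areas `A`. -/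
def moduleDim (A : Fin n → ℝ) (i : Fin n) : Fin 2 → ℝ := ![P.w i (A i), P.h i (A i)]

/-- The constraints `constraint A j c ≤ 0`, which say that every module lies in the outline:
`wᵢ / 2 ≤ xᵢ ≤ W - wᵢ / 2` and `hᵢ / 2 ≤ yᵢ ≤ H - hᵢ / 2`. The index consists of the module,
the coordinate, and the side (`false` for the lower and `true` for the upper bound). -/
def constraint (A : Fin n → ℝ) (j : Fin n × Fin 2 × Bool) (c : Config n) : ℝ :=
  if j.2.2 then c j.1 j.2.1 - (P.outline j.2.1 - P.moduleDim A j.1 j.2.1 / 2)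
  else P.moduleDim A j.1 j.2.1 / 2 - c j.1 j.2.1

end Problem

/-! ### Constrained minimizers -/

section Constrained

variable {E J : Type*} [NormedAddCommGroup E] [NormedSpace ℝ E]

/-- `c` is a local minimizer of `f` subject to `g j ≤ 0` for all `j`. -/
def IsLocalMinimizer (f : E → ℝ) (g : J → E → ℝ) (c : E) : Prop :=
  (∀ j, g j c ≤ 0) ∧ IsLocalMinOn f {x | ∀ j, g j x ≤ 0} c

/-- `c` is regular for the constraints `g j ≤ 0`: the gradients of the active constraints are
linearly independent. -/
def IsRegularPoint (g : J → E → ℝ) (c : E) : Prop :=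
  LinearIndependent ℝ (fun j : {j // g j c = 0} => fderiv ℝ (g j.1) c)

/-- The critical cone at `c` of the problem `min f` subject to `g j ≤ 0`. -/
def criticalCone (f : E → ℝ) (g : J → E → ℝ) (c : E) : Set E :=
  {d | (∀ j, g j c = 0 → fderiv ℝ (g j) c d ≤ 0) ∧ fderiv ℝ f c d = 0}

/-- The (strong) second-order sufficiency condition for affine constraints `g j ≤ 0`, for which
the Hessian of the Lagrangian is that of `f`: it is positive definite on the linear span of the
critical cone. -/
def SecondOrderSufficient (f : E → ℝ) (g : J → E → ℝ) (c : E) : Prop :=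
  ∀ d ∈ Submodule.span ℝ (criticalCone f g c), d ≠ 0 → 0 < fderiv ℝ (fderiv ℝ f) c d d

end Constrained

end PeF

end

/-! The proof has an analytic half, the joint `C²` regularity of the objective
(`contDiffAt_objective`), and a variational half, the stability of local minimizers of any jointly
`C²` objective (`stability_of_contDiffAt`).

Variational half. Every constraint bounds a single coordinate, and regularity excludes that both
bounds of one coordinate are active. Near the base point the feasible set is therefore one fixed set
of sign conditions on coordinates, translated by half the change of the module dimensions in the
active coordinates (`eventually_feasible_iff`). Pulling the objective back by this `C²` translation
leaves a `C²` objective on a fixed closed convex set. The coordinates then split into two groups.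
Where the partial derivative at the base point vanishes, plus or minus the unit vector lies in the
critical cone, so the Hessian is positive definite on the span of these coordinates. Where it does
not vanish, the first-order condition fixes its sign and the objective grows linearly.

`exists_lipschitz_localMinimizer` minimizes over the slice of the convex set in the coordinates of
the first group. The gradient is strongly monotone along the slice; adding the variational
inequalities of two minimizers gives uniqueness and the Lipschitz bound. Linear growth turns the
slice minimizer into a local minimizer on the whole set and forces every nearby local minimizer into
the slice. Strict complementarity is not needed.

Analytic half. Rescaling a module to the unit square moves its dimensions from the domain of
integration into a smooth integrand, so the density is a smooth map from centres and dimensions to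
continuous functions on the closed outline, and from there to `L²`. The energy is half the squared
norm of a bounded linear operator applied to the source (`exists_solutionOperator`), hence as smooth
as the widths and heights allow. The operator comes from Lax–Milgram on mean-zero `H¹`, with
coercivity from the Poincaré inequality (`exists_poincare`). That inequality is proved by duality:
up to a multiple of a fixed bump, a test function is the divergence of a field of test functions
bounded in `L²` (`exists_divergence_decomposition`), and such a field can be inserted directly into
the definition of the weak gradient. -/

noncomputable section

namespace PeF

/-! ### Smooth dependence on a parameter, in the supremum norm -/

section ParametricContinuousMap

universe u
variable {K : Type*} [TopologicalSpace K] [CompactSpace K]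
  {Q F : Type u} [NormedAddCommGroup Q] [NormedSpace ℝ Q] [NormedAddCommGroup F] [NormedSpace ℝ F]

/-- A continuous family of linear maps, as a linear map into continuous functions. -/
def evalFamily (K : Type*) [TopologicalSpace K] [CompactSpace K]
    (Q F : Type u) [NormedAddCommGroup Q] [NormedSpace ℝ Q] [NormedAddCommGroup F]
    [NormedSpace ℝ F] : C(K, Q →L[ℝ] F) →L[ℝ] (Q →L[ℝ] C(K, F)) :=
  LinearMap.mkContinuous₂
    (LinearMap.mk₂ ℝ (fun (D : C(K, Q →L[ℝ] F)) (v : Q) =>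
        (⟨fun x => D x v, by fun_prop⟩ : C(K, F)))
      (fun _ _ _ => by ext; simp) (fun _ _ _ => by ext; simp)
      (fun _ _ _ => by ext; simp) (fun _ _ _ => by ext; simp)) 1
    (fun D v => by
      rw [one_mul]
      refine (ContinuousMap.norm_le _ (by positivity)).2 fun x => ?_
      exact (D x).le_of_opNorm_le (D.norm_coe_le_norm x) v)

@[simp] theorem evalFamily_apply (D : C(K, Q →L[ℝ] F)) (v : Q) (x : K) :
    evalFamily K Q F D v x = D x v := rfl

/-- If `Φ p x` is continuously differentiable in `p`, uniformly in `x`, then `p ↦ Φ p ·` is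
differentiable as a map into continuous functions. -/
theorem hasFDerivAt_of_forall_hasFDerivAt {Φ : Q → C(K, F)} {D : Q → C(K, Q →L[ℝ] F)}
    (hD : Continuous D) (h : ∀ p x, HasFDerivAt (fun q => Φ q x) (D p x) p) (p : Q) :
    HasFDerivAt Φ (evalFamily K Q F (D p)) p := by
  rw [hasFDerivAt_iff_isLittleO, Asymptotics.isLittleO_iff]
  intro c hc
  -- Continuity of `D` in the supremum norm yields one radius `δ` that serves every `x`, so the mean
  -- value bound below is uniform in `x`.
  obtain ⟨δ, hδ, hball⟩ := Metric.eventually_nhds_iff_ball.1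
    (Metric.tendstoUniformly_iff.1 (ContinuousMap.tendsto_iff_tendstoUniformly.1 (hD.tendsto p)) c hc)
  filter_upwards [Metric.ball_mem_nhds p hδ] with q hq
  refine (ContinuousMap.norm_le _ (by positivity)).2 fun x => ?_
  have := (convex_ball p δ).norm_image_sub_le_of_norm_hasFDerivWithin_le' (f := fun q => Φ q x)
    (f' := fun q => D q x) (φ := D p x) (C := c) (fun y _ => (h y x).hasFDerivWithinAt)
    (fun y hy => ?_) (Metric.mem_ball_self hδ) hq
  · simpa using this
  · rw [← dist_eq_norm, dist_comm]
    exact (hball y hy x).le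

/-- A jointly smooth function, restricted to a compact set in the second variable, is smooth as a
map into continuous functions. -/
theorem contDiff_continuousMap {X : Type*} [NormedAddCommGroup X] [NormedSpace ℝ X] {S : Set X}
    [CompactSpace S] (n : ℕ) {Φ : Q × X → F} (hΦ : ContDiff ℝ n Φ) :
    ContDiff ℝ n (fun p => (⟨fun x => Φ (p, x), hΦ.continuous.comp (by fun_prop)⟩ : C(S, F))) := by
  -- The parameter derivative is a family of the same kind with values in `Q →L[ℝ] F`; this is why
  -- `F` varies in the induction and shares a universe with `Q`.
  induction n generalizing F with
  | zero =>
    exact contDiff_zero.2 (ContinuousMap.curry ⟨fun q : Q × S => Φ (q.1, q.2),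
      hΦ.continuous.comp (by fun_prop)⟩).continuous
  | succ n ih =>
    have hd : ContDiff ℝ n (fun q : Q × X => (fderiv ℝ Φ q).comp (ContinuousLinearMap.inl ℝ Q X)) :=
      (hΦ.fderiv_right (m := n) (by norm_cast)).clm_comp contDiff_const
    refine contDiff_succ_iff_hasFDerivAt.2 ⟨_, (evalFamily S Q F).contDiff.comp (ih hd), fun p => ?_⟩
    refine hasFDerivAt_of_forall_hasFDerivAt (ih hd).continuous (fun p x => ?_) p
    have h1 : HasFDerivAt Φ (fderiv ℝ Φ (p, (x : X))) (p, (x : X)) :=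
      (hΦ.differentiable (by norm_cast) _).hasFDerivAt
    exact h1.comp p (hasFDerivAt_prodMk_left p (x : X))

end ParametricContinuousMap

/-! ### Stability of minimizers on a fixed convex set -/

section Stability

variable {E Q : Type*} [NormedAddCommGroup E] [NormedSpace ℝ E] [NormedAddCommGroup Q]
  [NormedSpace ℝ Q]

/-- The first-order condition at a local minimum on a convex set. -/
theorem variationalInequality_of_isLocalMinOn {f : E → ℝ} {f' : E →L[ℝ] ℝ} {C : Set E} {x z : E}
    (hC : Convex ℝ C) (h : IsLocalMinOn f C x) (hf : HasFDerivAt f f' x) (hx : x ∈ C)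
    (hz : z ∈ C) : 0 ≤ f' (z - x) :=
  h.hasFDerivWithinAt_nonneg hf.hasFDerivWithinAt
    (sub_mem_posTangentConeAt_of_segment_subset (hC.segment_subset hx hz))

/-- The partial derivative with respect to the first variable. -/
def partialFDeriv (F : E × Q → ℝ) (q : E × Q) : E →L[ℝ] ℝ :=
  (fderiv ℝ F q).comp (ContinuousLinearMap.inl ℝ E Q)

theorem hasFDerivAt_partialFDeriv {F : E × Q → ℝ} {x : E} {p : Q}
    (h : DifferentiableAt ℝ F (x, p)) :
    HasFDerivAt (fun y => F (y, p)) (partialFDeriv F (x, p)) x :=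
  h.hasFDerivAt.comp x (hasFDerivAt_prodMk_left x p)

theorem contDiffAt_partialFDeriv {F : E × Q → ℝ} {q : E × Q} (h : ContDiffAt ℝ 2 F q) :
    ContDiffAt ℝ 1 (partialFDeriv F) q :=
  (h.fderiv_right (m := 1) (by norm_num)).clm_comp contDiffAt_const

/-- Links the Hessian at a frozen parameter, on which the second-order condition is imposed, to the
joint derivative of the partial gradient, which also controls the dependence on the parameter. -/
theorem fderiv_fderiv_eq_partialFDeriv {F : E × Q → ℝ} {x : E} {p : Q}
    (h : ContDiffAt ℝ 2 F (x, p)) (d : E) :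
    fderiv ℝ (fderiv ℝ (fun y => F (y, p))) x d = fderiv ℝ (partialFDeriv F) (x, p) (d, 0) := by
  have hev : fderiv ℝ (fun y => F (y, p)) =ᶠ[𝓝 x] fun y => partialFDeriv F (y, p) := by
    have h1 : ∀ᶠ q in 𝓝 (x, p), ContDiffAt ℝ 2 F q := h.eventually (by simp)
    have h2 : Tendsto (fun y : E => (y, p)) (𝓝 x) (𝓝 (x, p)) :=
      (Continuous.prodMk_left p).tendsto x
    filter_upwards [h2.eventually h1] with y hy
    exact (hasFDerivAt_partialFDeriv (hy.differentiableAt (by norm_num))).fderiv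
  rw [hev.fderiv_eq]
  have h2 : HasFDerivAt (partialFDeriv F) (fderiv ℝ (partialFDeriv F) (x, p)) (x, p) :=
    ((contDiffAt_partialFDeriv h).differentiableAt one_ne_zero).hasFDerivAt
  have h3 : HasFDerivAt (fun y => partialFDeriv F (y, p)) _ x :=
    HasFDerivAt.comp (f := fun y : E => (y, p)) x h2 (hasFDerivAt_prodMk_left (𝕜 := ℝ) x p)
  exact congrArg (fun T => T d) h3.fderiv

/-- A bilinear form that is positive on a subspace of a finite-dimensional space is coercive
there. -/
theorem exists_coercive_of_pos [FiniteDimensional ℝ E] (B : E →L[ℝ] E →L[ℝ] ℝ) (π : E →L[ℝ] E)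
    (hpos : ∀ d, π d = d → d ≠ 0 → 0 < B d d) :
    ∃ α > 0, ∀ d, π d = d → α * ‖d‖ ^ 2 ≤ B d d := by
  have hcomp : IsCompact (Metric.sphere (0 : E) 1 ∩ {d | π d = d}) :=
    (isCompact_sphere 0 1).inter_right (isClosed_eq π.continuous continuous_id)
  have hcont : Continuous fun d => B d d := by fun_prop
  obtain ⟨α, hα, hle⟩ := hcomp.exists_forall_le' (f := fun d => B d d) hcont.continuousOn (a := 0)
    (fun d hd => hpos d hd.2 (by
      rintro rfl
      simpa using hd.1))
  refine ⟨α, hα, fun d hd => ?_⟩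
  rcases eq_or_ne d 0 with rfl | h0
  · simp
  have hn : 0 < ‖d‖ := norm_pos_iff.2 h0
  have := hle (‖d‖⁻¹ • d) ⟨by simp [norm_smul, hn.ne'], by simp [hd]⟩
  simp only [map_smul, smul_apply, smul_eq_mul] at this
  have h2 := mul_le_mul_of_nonneg_right this (sq_nonneg ‖d‖)
  calc α * ‖d‖ ^ 2 ≤ _ := h2
    _ = B d d := by field_simp

/-- Strong stability of local minimizers on a fixed closed convex set `C`. The map `π` projects onto
the directions in which the second-order condition is assumed; in the complementary directions
the objective increases at a linear rate. -/
theorem exists_lipschitz_localMinimizer [FiniteDimensional ℝ E] {C : Set E} (hC : IsClosed C)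
    (hconv : Convex ℝ C) {x₀ : E} {p₀ : Q} (hx₀ : x₀ ∈ C) (π : E →L[ℝ] E)
    (hππ : ∀ z, π (π z) = π z) (hπC : ∀ x ∈ C, x₀ + π (x - x₀) ∈ C) {F : E × Q → ℝ}
    (hF : ContDiffAt ℝ 2 F (x₀, p₀)) (hmin : IsLocalMinOn (fun x => F (x, p₀)) C x₀)
    {κ : ℝ} (hκ : 0 < κ)
    (hstrict : ∀ x ∈ C, κ * ‖x - x₀ - π (x - x₀)‖ ≤
      fderiv ℝ (fun x => F (x, p₀)) x₀ (x - x₀ - π (x - x₀)))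
    (hpos : ∀ d, π d = d → d ≠ 0 → 0 < fderiv ℝ (fderiv ℝ (fun x => F (x, p₀))) x₀ d d) :
    ∃ r₀ > 0, ∀ r, 0 < r → r ≤ r₀ → ∃ δ > 0, ∃ (s : Q → E) (K : NNReal), s p₀ = x₀ ∧
      LipschitzOnWith K s (Metric.ball p₀ δ) ∧ ∀ p ∈ Metric.ball p₀ δ, ∀ x,
        (x ∈ Metric.ball x₀ r ∧ x ∈ C ∧ IsLocalMinOn (fun x => F (x, p)) C x) ↔ x = s p := by
  set f' := partialFDeriv F with hf'
  set H := fderiv ℝ f' (x₀, p₀) with hH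
  obtain ⟨β, hβ, hcoer⟩ := exists_coercive_of_pos
    (H.comp (ContinuousLinearMap.inl ℝ E Q)) π (fun d hd h0 => by
      have := hpos d hd h0
      rwa [fderiv_fderiv_eq_partialFDeriv hF] at this)
  have hstr : HasStrictFDerivAt f' H (x₀, p₀) :=
    (contDiffAt_partialFDeriv hF).hasStrictFDerivAt (by norm_num)
  have e1 : ∀ᶠ q in 𝓝 (x₀, p₀), DifferentiableAt ℝ F q :=
    (hF.eventually (by simp)).mono fun q hq => hq.differentiableAt (by norm_num)
  have e2 : ∀ᶠ q in 𝓝 (x₀, p₀), ‖f' q - f' (x₀, p₀)‖ < κ / 2 := by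
    have := (contDiffAt_partialFDeriv hF).continuousAt
    filter_upwards [Metric.tendsto_nhds.1 this (κ / 2) (by positivity)] with q hq
    rwa [← dist_eq_norm]
  -- Strict differentiability compares two arbitrary nearby points with the single linear map `H`.
  -- The error `β / 2` leaves half of the coercivity constant `β` for strong monotonicity.
  have e3 : ∀ᶠ q : (E × Q) × (E × Q) in 𝓝 ((x₀, p₀), (x₀, p₀)),
      ‖f' q.1 - f' q.2 - H (q.1 - q.2)‖ ≤ β / 2 * ‖q.1 - q.2‖ :=
    hstr.isLittleO.bound (by positivity)
  obtain ⟨ρ₁, hρ₁, e12⟩ := Metric.eventually_nhds_iff_ball.1 (e1.and e2)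
  obtain ⟨ρ₂, hρ₂, e3⟩ := Metric.eventually_nhds_iff_ball.1 e3
  set ρ := min ρ₁ ρ₂ with hρdef
  have hρ : 0 < ρ := lt_min hρ₁ hρ₂
  have memρ : ∀ {x : E} {p : Q}, x ∈ Metric.ball x₀ ρ → p ∈ Metric.ball p₀ ρ →
      (x, p) ∈ Metric.ball (x₀, p₀) ρ := fun hx hp => by
    rw [← ball_prod_same]; exact ⟨hx, hp⟩
  have hder : ∀ {x : E} {p : Q}, x ∈ Metric.ball x₀ ρ → p ∈ Metric.ball p₀ ρ →
      HasFDerivAt (fun y => F (y, p)) (f' (x, p)) x := fun hx hp =>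
    hasFDerivAt_partialFDeriv
      (e12 _ (Metric.ball_subset_ball (min_le_left _ _) (memρ hx hp))).1
  have hlin : ∀ {q q' : E × Q}, q ∈ Metric.ball (x₀, p₀) ρ → q' ∈ Metric.ball (x₀, p₀) ρ →
      ‖f' q - f' q' - H (q - q')‖ ≤ β / 2 * ‖q - q'‖ := fun {q q'} hq hq' => by
    refine e3 (q, q') ?_
    rw [← ball_prod_same]
    exact ⟨Metric.ball_subset_ball (min_le_right _ _) hq,
      Metric.ball_subset_ball (min_le_right _ _) hq'⟩
  have hmono : ∀ {x y : E} {p : Q}, x ∈ Metric.ball x₀ ρ → y ∈ Metric.ball x₀ ρ →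
      p ∈ Metric.ball p₀ ρ → π (x - y) = x - y →
      β / 2 * ‖x - y‖ ^ 2 ≤ (f' (x, p) - f' (y, p)) (x - y) := by
    intro x y p hx hy hp hxy
    have h1 := hlin (memρ hx hp) (memρ hy hp)
    have hsub : ((x, p) : E × Q) - (y, p) = (x - y, 0) := by simp
    have hno : ‖((x - y, 0) : E × Q)‖ = ‖x - y‖ := by simp [Prod.norm_def]
    rw [hsub, hno] at h1
    have h2 := (f' (x, p) - f' (y, p) - H (x - y, 0)).le_of_opNorm_le h1 (x - y)
    have h3 : β * ‖x - y‖ ^ 2 ≤ H (x - y, 0) (x - y) := hcoer _ hxy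
    have h4 := neg_le_of_abs_le (Real.norm_eq_abs _ ▸ h2)
    rw [sub_apply _ (H (x - y, 0))] at h4
    nlinarith
  set M := ‖H‖ + β / 2 with hM
  have hM0 : 0 ≤ M := by positivity
  have hlip : ∀ {x : E} {p p' : Q}, x ∈ Metric.ball x₀ ρ → p ∈ Metric.ball p₀ ρ →
      p' ∈ Metric.ball p₀ ρ → ‖f' (x, p) - f' (x, p')‖ ≤ M * ‖p - p'‖ := by
    intro x p p' hx hp hp'
    have h1 := hlin (memρ hx hp) (memρ hx hp')
    have hno : ‖((x, p) : E × Q) - (x, p')‖ = ‖p - p'‖ := by simp [Prod.norm_def]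
    rw [hno] at h1
    have h2 := H.le_opNorm ((x, p) - (x, p'))
    rw [hno] at h2
    have h3 := norm_sub_norm_le (f' (x, p) - f' (x, p')) (H ((x, p) - (x, p')))
    rw [hM]
    linarith
  have hgrow : ∀ {x : E} {p : Q} {z : E}, x ∈ Metric.ball x₀ ρ → p ∈ Metric.ball p₀ ρ → z ∈ C →
      κ / 2 * ‖z - x₀ - π (z - x₀)‖ ≤ f' (x, p) (z - x₀ - π (z - x₀)) := by
    intro x p z hx hp hz
    have h0 := (e12 _ (Metric.ball_subset_ball (min_le_left _ _) (memρ hx hp))).2.le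
    have h1 := (f' (x, p) - f' (x₀, p₀)).le_of_opNorm_le h0 (z - x₀ - π (z - x₀))
    have h2 := hstrict z hz
    rw [(hder (Metric.mem_ball_self hρ) (Metric.mem_ball_self hρ)).fderiv] at h2
    have h4 := neg_le_of_abs_le (Real.norm_eq_abs _ ▸ h1)
    rw [sub_apply] at h4
    linarith
  -- The minimization takes place on a compact slice. The radius `r / 2` keeps it inside the ball of
  -- radius `r`, and for `p` close to `p₀` the ball constraint turns out to be inactive.
  refine ⟨ρ, hρ, fun r hr hrρ => ?_⟩
  set D := C ∩ {x | π (x - x₀) = x - x₀} ∩ Metric.closedBall x₀ (r / 2) with hD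
  have hDb : ∀ {x}, x ∈ D → x ∈ Metric.ball x₀ ρ := fun hx =>
    Metric.closedBall_subset_ball (by linarith) hx.2
  have hDcomp : IsCompact D := (isCompact_closedBall x₀ (r / 2)).inter_left
    (hC.inter (isClosed_eq (by fun_prop) (by fun_prop)))
  have hDconv : Convex ℝ D := by
    refine (hconv.inter ?_).inter (convex_closedBall _ _)
    intro x hx y hy a b _ _ hab
    have : a • x + b • y - x₀ = a • (x - x₀) + b • (y - x₀) := by
      have : x₀ = (a + b) • x₀ := by rw [hab, one_smul]
      rw [smul_sub, smul_sub]
      nth_rewrite 1 [this]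
      rw [add_smul]; abel
    simp only [mem_ofPred_eq] at hx hy ⊢
    rw [this, map_add, map_smul, map_smul, hx, hy]
  have hx₀D : x₀ ∈ D := ⟨⟨hx₀, by simp⟩, Metric.mem_closedBall_self (by positivity)⟩
  -- The implication makes the choice total: for `p` outside the ball, `x₀` is a default value
  -- without meaning.
  have hex : ∀ p, ∃ m ∈ D, p ∈ Metric.ball p₀ ρ → IsMinOn (fun x => F (x, p)) D m := by
    intro p
    by_cases hp : p ∈ Metric.ball p₀ ρ
    · obtain ⟨m, hm, hmm⟩ := hDcomp.exists_isMinOn ⟨x₀, hx₀D⟩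
        (f := fun x => F (x, p)) fun x hx => (hder (hDb hx) hp).continuousAt.continuousWithinAt
      exact ⟨m, hm, fun _ => hmm⟩
    · exact ⟨x₀, hx₀D, fun h => absurd h hp⟩
  choose s hsD hsmin using hex
  have hVI : ∀ {p z}, p ∈ Metric.ball p₀ ρ → z ∈ D → 0 ≤ f' (s p, p) (z - s p) := fun {p z} hp hz =>
    variationalInequality_of_isLocalMinOn hDconv (hsmin p hp).localize (hder (hDb (hsD p)) hp)
      (hsD p) hz
  have hDsub : ∀ {x y}, π (x - x₀) = x - x₀ → π (y - x₀) = y - x₀ → π (x - y) = x - y := by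
    intro x y hx hy
    rw [← sub_sub_sub_cancel_right x y x₀, map_sub, hx, hy]
  have hslip : ∀ {p p'}, p ∈ Metric.ball p₀ ρ → p' ∈ Metric.ball p₀ ρ →
      ‖s p - s p'‖ ≤ M / (β / 2) * ‖p - p'‖ := by
    intro p p' hp hp'
    have h1 := hVI hp (hsD p')
    have h2 := hVI hp' (hsD p)
    have h3 := hmono (hDb (hsD p)) (hDb (hsD p')) hp (hDsub (hsD p).1.2 (hsD p').1.2)
    have h4 := (f' (s p', p) - f' (s p', p')).le_of_opNorm_le
      (hlip (hDb (hsD p')) hp hp') (s p - s p')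
    rw [Real.norm_eq_abs] at h4
    have h5 := neg_le_of_abs_le h4
    rw [← neg_sub, map_neg] at h1
    simp only [sub_apply] at h3 h5
    have h6 : β / 2 * ‖s p - s p'‖ ^ 2 ≤ M * ‖p - p'‖ * ‖s p - s p'‖ := by linarith
    rcases (norm_nonneg (s p - s p')).eq_or_lt with h0 | h0
    · rw [← h0]; positivity
    · rw [div_mul_eq_mul_div, le_div_iff₀ (by positivity)]
      nlinarith
  have hp₀ : p₀ ∈ Metric.ball p₀ ρ := Metric.mem_ball_self hρ
  have hs₀ : s p₀ = x₀ := by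
    have h1 := hVI hp₀ hx₀D
    have h2 := variationalInequality_of_isLocalMinOn hconv hmin
      (hder (Metric.mem_ball_self hρ) hp₀) hx₀ (hsD p₀).1.1
    have h3 := hmono (hDb (hsD p₀)) (Metric.mem_ball_self hρ) hp₀ (hsD p₀).1.2
    rw [← neg_sub, map_neg] at h1
    rw [sub_apply] at h3
    have h4 : ‖s p₀ - x₀‖ ^ 2 ≤ 0 := by nlinarith
    exact sub_eq_zero.1 (norm_eq_zero.1 (pow_eq_zero_iff two_ne_zero |>.1
      (le_antisymm h4 (sq_nonneg _))))
  set N := M / (β / 2) with hN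
  have hN0 : 0 ≤ N := by positivity
  -- With this radius the Lipschitz bound keeps `s p` at distance less than `r / 2` from `x₀`. The
  -- summand `1` avoids a division by zero when `N = 0`.
  refine ⟨min ρ (r / 2 / (N + 1)), lt_min hρ (by positivity), s, ⟨N, hN0⟩, hs₀, ?_, ?_⟩
  · refine LipschitzOnWith.of_dist_le_mul fun p hp p' hp' => ?_
    rw [dist_eq_norm, dist_eq_norm]
    exact hslip (Metric.ball_subset_ball (min_le_left _ _) hp)
      (Metric.ball_subset_ball (min_le_left _ _) hp')
  intro p hp'
  have hp : p ∈ Metric.ball p₀ ρ := Metric.ball_subset_ball (min_le_left _ _) hp'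
  have hsr : s p ∈ Metric.ball x₀ (r / 2) := by
    have h1 := hslip hp hp₀
    have h2 : ‖p - p₀‖ < r / 2 / (N + 1) := by
      rw [← dist_eq_norm]
      exact lt_of_lt_of_le hp' (min_le_right _ _)
    rw [lt_div_iff₀ (by positivity)] at h2
    rw [mem_ball_iff_norm, ← hs₀]
    nlinarith [norm_nonneg (p - p₀)]
  -- A point `z` of `C` near `s p` is compared with its projection to the slice: minimality of `s p`
  -- handles the projection, and linear growth, through the mean value theorem on the connecting
  -- segment, shows that projecting does not raise the value.
  have hsmin' : IsLocalMinOn (fun x => F (x, p)) C (s p) := by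
    have hcont : Tendsto (fun z => x₀ + π (z - x₀)) (𝓝 (s p)) (𝓝 (s p)) := by
      have : Continuous fun z => x₀ + π (z - x₀) := by fun_prop
      have h := this.tendsto (s p)
      simp only [show π (s p - x₀) = s p - x₀ from (hsD p).1.2, add_sub_cancel] at h
      exact h
    have hball : Metric.ball x₀ (r / 2) ∈ 𝓝 (s p) := Metric.isOpen_ball.mem_nhds hsr
    have hball' : ∀ᶠ z in 𝓝 (s p), z ∈ Metric.ball x₀ (r / 2) := hball
    have ev : ∀ᶠ z in 𝓝[C] s p, z ∈ Metric.ball x₀ (r / 2) ∧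
        x₀ + π (z - x₀) ∈ Metric.ball x₀ (r / 2) :=
      (hball'.and (hcont.eventually hball')).filter_mono nhdsWithin_le_nhds
    filter_upwards [ev, self_mem_nhdsWithin] with z hz hzC
    have hle : Metric.ball x₀ (r / 2) ⊆ Metric.ball x₀ ρ := Metric.ball_subset_ball (by linarith)
    have h1 : F (s p, p) ≤ F (x₀ + π (z - x₀), p) := hsmin p hp
      ⟨⟨hπC z hzC, by simp [hππ]⟩, Metric.ball_subset_closedBall hz.2⟩
    obtain ⟨y, hy, hyeq⟩ := domain_mvt (f := fun x => F (x, p)) (f' := fun x => f' (x, p))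
      (s := Metric.ball x₀ ρ) (fun x hx => (hder hx hp).hasFDerivWithinAt) (convex_ball _ _)
      (hle hz.2) (hle hz.1)
    have hyb := (convex_ball x₀ ρ).segment_subset (hle hz.2) (hle hz.1) hy
    have h2 := hgrow hyb hp hzC
    rw [← sub_sub] at hyeq
    have h3 : 0 ≤ κ / 2 * ‖z - x₀ - π (z - x₀)‖ := by positivity
    linarith
  refine fun x => ⟨fun ⟨hxr, hxC, hxmin⟩ => ?_, ?_⟩
  · have hxρ : x ∈ Metric.ball x₀ ρ := Metric.ball_subset_ball hrρ hxr
    have hxVI : ∀ z ∈ C, 0 ≤ f' (x, p) (z - x) := fun z hz =>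
      variationalInequality_of_isLocalMinOn hconv hxmin (hder hxρ hp) hxC hz
    -- Moving from `x` to its projection is feasible, yet would decrease the objective to first
    -- order if the transverse part were nonzero. Hence `x` lies in the slice, where strong
    -- monotonicity identifies it with `s p`.
    have hxL : π (x - x₀) = x - x₀ := by
      have h1 := hxVI _ (hπC x hxC)
      have h2 := hgrow hxρ hp hxC
      rw [show x₀ + π (x - x₀) - x = -(x - x₀ - π (x - x₀)) by abel, map_neg] at h1
      have h3 : ‖x - x₀ - π (x - x₀)‖ ≤ 0 := by
        by_contra hcon
        push Not at hcon
        nlinarith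
      exact (sub_eq_zero.1 (norm_le_zero_iff.1 h3)).symm
    have h1 := hxVI _ (hsD p).1.1
    have h2 := variationalInequality_of_isLocalMinOn hconv hsmin' (hder (hDb (hsD p)) hp)
      (hsD p).1.1 hxC
    have h3 := hmono hxρ (hDb (hsD p)) hp (hDsub hxL (hsD p).1.2)
    rw [← neg_sub, map_neg] at h1
    rw [sub_apply] at h3
    have h4 : ‖x - s p‖ ^ 2 ≤ 0 := by nlinarith
    exact sub_eq_zero.1 (norm_eq_zero.1 (pow_eq_zero_iff two_ne_zero |>.1
      (le_antisymm h4 (sq_nonneg _))))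
  · rintro rfl
    exact ⟨Metric.ball_subset_ball (by linarith) hsr, (hsD p).1.1, hsmin'⟩

end Stability

/-! ### Coordinates of placements and coordinate projections -/

section Coordinates

variable {n : ℕ}

/-- The unit vector of the `k`-th coordinate of the `i`-th centre. -/
def unitVec (j : Fin n × Fin 2) : Config n := Pi.single j.1 (EuclideanSpace.single j.2 1)

/-- The `k`-th coordinate of the `i`-th centre. -/
def coordCLM (j : Fin n × Fin 2) : Config n →L[ℝ] ℝ :=
  (EuclideanSpace.proj j.2).comp (ContinuousLinearMap.proj j.1)

@[simp] theorem coordCLM_apply (j : Fin n × Fin 2) (c : Config n) : coordCLM j c = c j.1 j.2 := rfl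

theorem coord_unitVec (j : Fin n × Fin 2) (i : Fin n) (k : Fin 2) :
    unitVec j i k = if (i, k) = j then 1 else 0 := by
  obtain ⟨i', k'⟩ := j
  by_cases hi : i = i'
  · subst hi; simp [unitVec]
  · simp [unitVec, hi]

theorem norm_unitVec (j : Fin n × Fin 2) : ‖unitVec j‖ = 1 := by
  simp [unitVec, Pi.norm_single]

theorem sum_coord_smul_unitVec (c : Config n) : ∑ j, c j.1 j.2 • unitVec j = c := by
  funext i
  ext k
  rw [Finset.sum_apply, WithLp.ofLp_sum, Finset.sum_apply]
  simp [coord_unitVec]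

theorem clm_apply_eq_sum (g : Config n →L[ℝ] ℝ) (c : Config n) :
    g c = ∑ j, c j.1 j.2 * g (unitVec j) := by
  conv_lhs => rw [← sum_coord_smul_unitVec c]
  simp

theorem norm_le_sum_abs_coord (c : Config n) : ‖c‖ ≤ ∑ j : Fin n × Fin 2, |c j.1 j.2| := by
  conv_lhs => rw [← sum_coord_smul_unitVec c]
  refine (norm_sum_le _ _).trans (Finset.sum_le_sum fun j _ => ?_)
  rw [norm_smul, norm_unitVec, mul_one, Real.norm_eq_abs]

open Classical in
/-- The coordinate projection that keeps the coordinates in `S`. -/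
def coordProj (S : Set (Fin n × Fin 2)) : Config n →L[ℝ] Config n :=
  ∑ j, if j ∈ S then (coordCLM j).smulRight (unitVec j) else 0

open Classical in
theorem coordProj_coord (S : Set (Fin n × Fin 2)) (c : Config n) (j : Fin n × Fin 2) :
    coordProj S c j.1 j.2 = if j ∈ S then c j.1 j.2 else 0 := by
  have : ∀ T : Config n →L[ℝ] Config n, T c j.1 j.2 = coordCLM j (T c) := fun _ => rfl
  rw [this, coordProj, sum_apply, map_sum]
  have h : ∀ x, coordCLM j ((if x ∈ S then (coordCLM x).smulRight (unitVec x) else 0) c) =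
      if x = j then (if j ∈ S then c j.1 j.2 else 0) else 0 := by
    intro x
    by_cases hx : x = j
    · subst hx
      by_cases hS : x ∈ S <;> simp [hS, coord_unitVec]
    · by_cases hS : x ∈ S <;> simp [hS, coord_unitVec, hx, Ne.symm hx]
  simp [h]

theorem config_ext {c d : Config n} (h : ∀ j : Fin n × Fin 2, c j.1 j.2 = d j.1 j.2) : c = d := by
  funext i
  ext k
  exact h (i, k)

end Coordinates

/-! ### Sets of sign conditions and the first-order condition on them -/

section BoxCone

variable {n : ℕ}

/-- The polyhedral set at `c₀` whose coordinates have a prescribed sign. -/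
def signedSet (c₀ : Config n) (σ : Fin n × Fin 2 → ℝ) : Set (Config n) :=
  {x | ∀ j, 0 ≤ σ j * (x j.1 j.2 - c₀ j.1 j.2)}

theorem isClosed_signedSet (c₀ : Config n) (σ : Fin n × Fin 2 → ℝ) :
    IsClosed (signedSet c₀ σ) := by
  have : signedSet c₀ σ = ⋂ j, {x | 0 ≤ σ j * (coordCLM j x - c₀ j.1 j.2)} := by
    ext x; simp [signedSet]
  rw [this]
  exact isClosed_iInter fun j => isClosed_le continuous_const (by fun_prop)

theorem convex_signedSet (c₀ : Config n) (σ : Fin n × Fin 2 → ℝ) :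
    Convex ℝ (signedSet c₀ σ) := by
  intro x hx y hy a b ha hb hab j
  have h1 := mul_nonneg ha (hx j)
  have h2 := mul_nonneg hb (hy j)
  have h3 : σ j * ((a • x + b • y) j.1 j.2 - c₀ j.1 j.2) =
      a * (σ j * (x j.1 j.2 - c₀ j.1 j.2)) + b * (σ j * (y j.1 j.2 - c₀ j.1 j.2)) := by
    have : b = 1 - a := by linarith
    subst this
    simp
    ring
  rw [h3]
  exact add_nonneg h1 h2

theorem self_mem_signedSet (c₀ : Config n) (σ : Fin n × Fin 2 → ℝ) : c₀ ∈ signedSet c₀ σ :=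
  fun j => by simp

theorem coordProj_mem_signedSet {c₀ : Config n} {σ : Fin n × Fin 2 → ℝ} (S : Set (Fin n × Fin 2))
    {x : Config n} (hx : x ∈ signedSet c₀ σ) : c₀ + coordProj S (x - c₀) ∈ signedSet c₀ σ := by
  intro j
  have h := coordProj_coord S (x - c₀) j
  have h1 : (c₀ + coordProj S (x - c₀)) j.1 j.2 - c₀ j.1 j.2 = coordProj S (x - c₀) j.1 j.2 := by
    simp
  rw [h1, h]
  split_ifs
  · exact hx j
  · simp

/-- At a minimum on a signed set, the partial derivatives have the corresponding signs. -/
theorem abs_apply_unitVec_of_variationalInequality {c₀ : Config n} {σ : Fin n × Fin 2 → ℝ}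
    {g : Config n →L[ℝ] ℝ} (h : ∀ z ∈ signedSet c₀ σ, 0 ≤ g (z - c₀)) (j : Fin n × Fin 2)
    (hσ : σ j = 0 ∨ |σ j| = 1) : |g (unitVec j)| = σ j * g (unitVec j) := by
  -- A coordinate may be moved alone whenever its own sign condition allows it, so the variational
  -- inequality decouples.
  have key : ∀ t : ℝ, 0 ≤ σ j * t → 0 ≤ t * g (unitVec j) := by
    intro t ht
    have := h (c₀ + t • unitVec j) (fun l => by
      by_cases hl : l = j
      · subst hl; simpa [coord_unitVec] using ht
      · simp [coord_unitVec, hl])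
    simpa using this
  rcases hσ with h0 | h1
  · have h2 := key 1 (by simp [h0])
    have h3 := key (-1) (by simp [h0])
    have : g (unitVec j) = 0 := by linarith
    simp [this]
  · have h2 := key (σ j) (mul_self_nonneg _)
    rw [← abs_of_nonneg h2, abs_mul, h1, one_mul]

/-- In the coordinates with nonzero partial derivative the objective grows at a linear rate. -/
theorem exists_linear_growth {c₀ : Config n} {σ : Fin n × Fin 2 → ℝ}
    {g : Config n →L[ℝ] ℝ} (hσ : ∀ j, σ j = 0 ∨ |σ j| = 1)
    (hg : ∀ j, |g (unitVec j)| = σ j * g (unitVec j)) :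
    ∃ κ > 0, ∀ x ∈ signedSet c₀ σ,
      κ * ‖x - c₀ - coordProj {j | g (unitVec j) = 0} (x - c₀)‖ ≤
        g (x - c₀ - coordProj {j | g (unitVec j) = 0} (x - c₀)) := by
  classical
  -- The rate is the least nonzero absolute partial derivative; if all of them vanish, any positive
  -- number serves.
  obtain ⟨κ, hκ, hle⟩ : ∃ κ > 0, ∀ j, g (unitVec j) ≠ 0 → κ ≤ |g (unitVec j)| := by
    have hfin : ({j | g (unitVec j) ≠ 0} : Set (Fin n × Fin 2)).Finite := Set.toFinite _
    rcases ({j | g (unitVec j) ≠ 0} : Set (Fin n × Fin 2)).eq_empty_or_nonempty with h | h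
    · exact ⟨1, one_pos, fun j hj => absurd (show j ∈ {j | g (unitVec j) ≠ 0} from hj)
        (by rw [h]; exact Set.notMem_empty j)⟩
    · obtain ⟨j₀, hj₀, hmin⟩ := hfin.exists_minimalFor (fun j => |g (unitVec j)|) _ h
      refine ⟨|g (unitVec j₀)|, abs_pos.2 hj₀, fun j hj => ?_⟩
      rcases le_total |g (unitVec j₀)| |g (unitVec j)| with h1 | h1
      · exact h1
      · exact hmin hj h1
  refine ⟨κ, hκ, fun x hx => ?_⟩
  set y := x - c₀ - coordProj {j | g (unitVec j) = 0} (x - c₀) with hy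
  have hyj : ∀ j, y j.1 j.2 = if g (unitVec j) = 0 then 0 else x j.1 j.2 - c₀ j.1 j.2 := by
    intro j
    have : y j.1 j.2 = (x - c₀) j.1 j.2 - coordProj {j | g (unitVec j) = 0} (x - c₀) j.1 j.2 := rfl
    rw [this, coordProj_coord]
    simp only [mem_ofPred_eq]
    split_ifs <;> simp
  rw [clm_apply_eq_sum g y]
  refine (mul_le_mul_of_nonneg_left (norm_le_sum_abs_coord y) hκ.le).trans ?_
  rw [Finset.mul_sum]
  refine Finset.sum_le_sum fun j _ => ?_
  rw [hyj]
  split_ifs with h0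
  · simp
  · have hs : |σ j| = 1 := (hσ j).resolve_left fun h => h0 (abs_eq_zero.1 (by rw [hg, h, zero_mul]))
    have hsq : σ j * σ j = 1 := by rw [← abs_mul_abs_self, hs, one_mul]
    have h1 : |x j.1 j.2 - c₀ j.1 j.2| = σ j * (x j.1 j.2 - c₀ j.1 j.2) := by
      rw [← abs_of_nonneg (hx j), abs_mul, hs, one_mul]
    have h2 : (x j.1 j.2 - c₀ j.1 j.2) * g (unitVec j) =
        |g (unitVec j)| * |x j.1 j.2 - c₀ j.1 j.2| := by
      rw [h1, hg j]
      linear_combination (-(x j.1 j.2 - c₀ j.1 j.2) * g (unitVec j)) * hsq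
    rw [h2]
    exact mul_le_mul_of_nonneg_right (hle j h0) (abs_nonneg _)

end BoxCone

/-! ### Active constraints and the motion of the feasible set -/

namespace Problem

variable {n : ℕ} (P : Problem n)

theorem hasFDerivAt_constraint_true (A : Fin n → ℝ) (i : Fin n) (k : Fin 2) (c : Config n) :
    HasFDerivAt (P.constraint A (i, k, true)) (coordCLM (i, k)) c := by
  have : P.constraint A (i, k, true) =
      fun c => coordCLM (i, k) c - (P.outline k - P.moduleDim A i k / 2) := by
    funext c; simp [constraint]
  rw [this]
  exact (coordCLM (i, k)).hasFDerivAt.sub_const _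

theorem hasFDerivAt_constraint_false (A : Fin n → ℝ) (i : Fin n) (k : Fin 2) (c : Config n) :
    HasFDerivAt (P.constraint A (i, k, false)) (-coordCLM (i, k)) c := by
  have : P.constraint A (i, k, false) =
      fun c => P.moduleDim A i k / 2 - coordCLM (i, k) c := by
    funext c; simp [constraint]
  rw [this]
  exact (coordCLM (i, k)).hasFDerivAt.const_sub _

/-- At a regular point, the two constraints of a coordinate are not both active. -/
theorem not_both_active {A : Fin n → ℝ} {c : Config n} (h : IsRegularPoint (P.constraint A) c)
    (i : Fin n) (k : Fin 2) (h0 : P.constraint A (i, k, false) c = 0) :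
    P.constraint A (i, k, true) c ≠ 0 := by
  intro h1
  -- The two gradients are opposite, so their sum is a nontrivial vanishing combination.
  have := linearIndependent_iff'.1 h {⟨(i, k, false), h0⟩, ⟨(i, k, true), h1⟩} (fun _ => 1)
    (by
      rw [Finset.sum_pair (by simp)]
      simp [(P.hasFDerivAt_constraint_false A i k c).fderiv,
        (P.hasFDerivAt_constraint_true A i k c).fderiv])
    ⟨(i, k, false), h0⟩ (by simp)
  exact one_ne_zero this

open Classical in
/-- The sign of the feasible directions in each coordinate; zero if no constraint is active. -/
def activeSign (A : Fin n → ℝ) (c : Config n) (j : Fin n × Fin 2) : ℝ :=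
  if P.constraint A (j.1, j.2, false) c = 0 then 1
  else if P.constraint A (j.1, j.2, true) c = 0 then -1 else 0

theorem activeSign_eq_zero_or (A : Fin n → ℝ) (c : Config n) (j : Fin n × Fin 2) :
    P.activeSign A c j = 0 ∨ |P.activeSign A c j| = 1 := by
  unfold activeSign
  split_ifs <;> simp

/-- The displacement that moves the active constraints at `A₀` to their position at `A`. -/
def activeShift (A₀ : Fin n → ℝ) (c₀ : Config n) (A : Fin n → ℝ) : Config n :=
  ∑ j, (P.activeSign A₀ c₀ j * ((P.moduleDim A j.1 j.2 - P.moduleDim A₀ j.1 j.2) / 2)) • unitVec j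

theorem activeShift_coord (A₀ : Fin n → ℝ) (c₀ : Config n) (A : Fin n → ℝ) (j : Fin n × Fin 2) :
    P.activeShift A₀ c₀ A j.1 j.2 =
      P.activeSign A₀ c₀ j * ((P.moduleDim A j.1 j.2 - P.moduleDim A₀ j.1 j.2) / 2) := by
  have : P.activeShift A₀ c₀ A j.1 j.2 = coordCLM j (P.activeShift A₀ c₀ A) := rfl
  rw [this, activeShift, map_sum]
  simp [coord_unitVec]

@[simp] theorem activeShift_self (A₀ : Fin n → ℝ) (c₀ : Config n) : P.activeShift A₀ c₀ A₀ = 0 := by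
  simp [activeShift]

theorem contDiffAt_width {A : Fin n → ℝ} (hA : ∀ i, 0 < A i) (i : Fin n) :
    ContDiffAt ℝ 2 (fun A : Fin n → ℝ => P.w i (A i)) A :=
  ((P.w_smooth i).contDiffAt (Ioi_mem_nhds (hA i))).comp A (contDiff_apply ℝ ℝ i).contDiffAt

theorem contDiffAt_height {A : Fin n → ℝ} (hA : ∀ i, 0 < A i) (i : Fin n) :
    ContDiffAt ℝ 2 (fun A : Fin n → ℝ => P.h i (A i)) A :=
  ((P.h_smooth i).contDiffAt (Ioi_mem_nhds (hA i))).comp A (contDiff_apply ℝ ℝ i).contDiffAt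

theorem contDiffAt_moduleDim {A : Fin n → ℝ} (hA : ∀ i, 0 < A i) (i : Fin n) (k : Fin 2) :
    ContDiffAt ℝ 2 (fun A : Fin n → ℝ => P.moduleDim A i k) A := by
  fin_cases k
  · exact P.contDiffAt_width hA i
  · exact P.contDiffAt_height hA i

theorem contDiffAt_activeShift {A₀ : Fin n → ℝ} (hA₀ : ∀ i, 0 < A₀ i) (c₀ : Config n) :
    ContDiffAt ℝ 2 (P.activeShift A₀ c₀) A₀ :=
  ContDiffAt.sum fun j _ => ((contDiffAt_const.mul
    (((P.contDiffAt_moduleDim hA₀ j.1 j.2).sub contDiffAt_const).div_const 2)).smul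
      contDiffAt_const)

/-- Near a regular feasible point, the feasible set is a translate of a fixed signed set. -/
theorem eventually_feasible_iff {A₀ : Fin n → ℝ} {c₀ : Config n} (hA₀ : ∀ i, 0 < A₀ i)
    (hfeas : ∀ j, P.constraint A₀ j c₀ ≤ 0) (hreg : IsRegularPoint (P.constraint A₀) c₀) :
    ∀ᶠ q : Config n × (Fin n → ℝ) in 𝓝 (c₀, A₀),
      (∀ j, P.constraint q.2 j q.1 ≤ 0) ↔
        q.1 - P.activeShift A₀ c₀ q.2 ∈ signedSet c₀ (P.activeSign A₀ c₀) := by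
  have hcont : ∀ i k b, ContinuousAt
      (fun q : Config n × (Fin n → ℝ) => P.constraint q.2 (i, k, b) q.1) (c₀, A₀) := by
    intro i k b
    have h1 : ContinuousAt (fun q : Config n × (Fin n → ℝ) => P.moduleDim q.2 i k) (c₀, A₀) :=
      ContinuousAt.comp (f := Prod.snd) (x := (c₀, A₀))
        (P.contDiffAt_moduleDim hA₀ i k).continuousAt continuousAt_snd
    have h2 : ContinuousAt (fun q : Config n × (Fin n → ℝ) => q.1 i k) (c₀, A₀) := by fun_prop
    cases b
    · exact ((h1.div_const 2).sub h2).congr (Eventually.of_forall fun q => by simp [constraint])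
    · exact (h2.sub (continuousAt_const (y := P.outline k) |>.sub (h1.div_const 2))).congr
        (Eventually.of_forall fun q => by simp [constraint])
  have hneg : ∀ i k b, P.constraint A₀ (i, k, b) c₀ ≠ 0 →
      ∀ᶠ q : Config n × (Fin n → ℝ) in 𝓝 (c₀, A₀), P.constraint q.2 (i, k, b) q.1 < 0 :=
    fun i k b h => (hcont i k b).eventually (gt_mem_nhds (lt_of_le_of_ne (hfeas _) h))
  -- Inactive constraints remain strict nearby and drop out. In each coordinate at most one
  -- constraint is left, and subtracting the shift puts its bound back at `c₀`.
  have hcoord : ∀ j : Fin n × Fin 2, ∀ᶠ q : Config n × (Fin n → ℝ) in 𝓝 (c₀, A₀),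
      (P.constraint q.2 (j.1, j.2, false) q.1 ≤ 0 ∧ P.constraint q.2 (j.1, j.2, true) q.1 ≤ 0) ↔
        0 ≤ P.activeSign A₀ c₀ j *
          (q.1 j.1 j.2 - P.activeShift A₀ c₀ q.2 j.1 j.2 - c₀ j.1 j.2) := by
    intro j
    by_cases hl : P.constraint A₀ (j.1, j.2, false) c₀ = 0
    · filter_upwards [hneg j.1 j.2 true (P.not_both_active hreg _ _ hl)] with q hq
      have hs : P.activeSign A₀ c₀ j = 1 := by simp [activeSign, hl]
      rw [activeShift_coord, hs]
      simp only [constraint, Bool.false_eq_true, if_false] at hl ⊢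
      exact ⟨fun h => by linarith [h.1], fun h => ⟨by linarith, hq.le⟩⟩
    by_cases hu : P.constraint A₀ (j.1, j.2, true) c₀ = 0
    · filter_upwards [hneg j.1 j.2 false hl] with q hq
      have hs : P.activeSign A₀ c₀ j = -1 := by simp [activeSign, hl, hu]
      rw [activeShift_coord, hs]
      simp only [constraint, if_true] at hu ⊢
      exact ⟨fun h => by linarith [h.2], fun h => ⟨hq.le, by linarith⟩⟩
    · filter_upwards [hneg j.1 j.2 false hl, hneg j.1 j.2 true hu] with q hq1 hq2
      have hs : P.activeSign A₀ c₀ j = 0 := by simp [activeSign, hl, hu]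
      simp [hs, hq1.le, hq2.le]
  filter_upwards [eventually_all.2 hcoord] with q hq
  refine ⟨fun h j => (hq j).1 ⟨h _, h _⟩, fun h j => ?_⟩
  obtain ⟨i, k, b⟩ := j
  have := (hq (i, k)).2 (h (i, k))
  cases b
  · exact this.1
  · exact this.2

end Problem

/-- Local minimality only depends on the set near the point, so it suffices that the two sets
correspond under translation there; the translations map the two within-neighbourhood filters to
each other. -/
theorem isLocalMinOn_translate {n : ℕ} {f : Config n → ℝ} {C S : Set (Config n)} {s c : Config n}
    (h : ∀ᶠ z in 𝓝 c, z ∈ S ↔ z - s ∈ C) :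
    IsLocalMinOn f S c ↔ IsLocalMinOn (fun x => f (x + s)) C (c - s) := by
  have h1 : Tendsto (fun x : Config n => x + s) (𝓝 (c - s)) (𝓝 c) := by
    have : Continuous fun x : Config n => x + s := by fun_prop
    simpa using this.tendsto (c - s)
  have h2 : Tendsto (fun x : Config n => x - s) (𝓝 c) (𝓝 (c - s)) := by
    have : Continuous fun x : Config n => x - s := by fun_prop
    exact this.tendsto c
  have t1 : Tendsto (fun x : Config n => x + s) (𝓝[C] (c - s)) (𝓝[S] c) := by
    refine tendsto_nhdsWithin_iff.2 ⟨h1.mono_left nhdsWithin_le_nhds, ?_⟩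
    filter_upwards [nhdsWithin_le_nhds (h1.eventually h), self_mem_nhdsWithin] with x hx hxC
    exact hx.2 (by simpa using hxC)
  have t2 : Tendsto (fun x : Config n => x - s) (𝓝[S] c) (𝓝[C] (c - s)) := by
    refine tendsto_nhdsWithin_iff.2 ⟨h2.mono_left nhdsWithin_le_nhds, ?_⟩
    filter_upwards [nhdsWithin_le_nhds h, self_mem_nhdsWithin] with x hx hxS
    exact hx.1 hxS
  constructor
  · intro hm
    have hm' : IsMinFilter f (𝓝[S] c) ((fun x : Config n => x + s) (c - s)) := by
      simpa only [sub_add_cancel] using (show IsMinFilter f (𝓝[S] c) c from hm)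
    exact IsMinFilter.comp_tendsto (g := fun x : Config n => x + s) hm' t1
  · intro hm
    have := IsMinFilter.comp_tendsto (g := fun x : Config n => x - s) (b := c) hm t2
    simp only [Function.comp_def, sub_add_cancel] at this
    exact this

/-! ### The second-order condition and stability for `C²` objectives -/

namespace Problem

variable {n : ℕ} (P : Problem n)

/-- The second-order condition gives positivity in the directions whose partial derivatives
vanish. -/
theorem pos_of_secondOrderSufficient {A : Fin n → ℝ} {c : Config n} {f : Config n → ℝ}
    (hreg : IsRegularPoint (P.constraint A) c)
    (hsosc : SecondOrderSufficient f (P.constraint A) c) {d : Config n}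
    (hd : coordProj {j | fderiv ℝ f c (unitVec j) = 0} d = d) (h0 : d ≠ 0) :
    0 < fderiv ℝ (fderiv ℝ f) c d d := by
  classical
  refine hsosc d ?_ h0
  rw [← sum_coord_smul_unitVec d]
  refine Submodule.sum_mem _ fun j _ => ?_
  by_cases hj : fderiv ℝ f c (unitVec j) = 0
  swap
  · have := coordProj_coord {j | fderiv ℝ f c (unitVec j) = 0} d j
    rw [hd, if_neg (by exact hj)] at this
    rw [this, zero_smul]
    exact Submodule.zero_mem _
  refine Submodule.smul_mem _ _ ?_
  have hconstr : ∀ (t : ℝ) (l : Fin n × Fin 2 × Bool),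
      fderiv ℝ (P.constraint A l) c (t • unitVec j) =
        if (l.1, l.2.1) = j then (if l.2.2 then t else -t) else 0 := by
    rintro t ⟨i, k, b⟩
    cases b
    · rw [(P.hasFDerivAt_constraint_false A i k c).fderiv]
      by_cases h : (i, k) = j <;> simp [coord_unitVec, h]
    · rw [(P.hasFDerivAt_constraint_true A i k c).fderiv]
      by_cases h : (i, k) = j <;> simp [coord_unitVec, h]
  -- At most one bound of the coordinate is active, so one of the two orientations of the unit
  -- vector is feasible to first order; the span contains both.
  by_cases hu : P.constraint A (j.1, j.2, true) c = 0
  · have hl : P.constraint A (j.1, j.2, false) c ≠ 0 := fun h =>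
      P.not_both_active hreg _ _ h hu
    have : (-1 : ℝ) • unitVec j ∈ criticalCone f (P.constraint A) c := by
      refine ⟨fun l hact => ?_, by simp [hj]⟩
      rw [hconstr]
      obtain ⟨i, k, b⟩ := l
      split_ifs with h1 h2
      · norm_num
      · simp only [Bool.not_eq_true] at h2
        subst h1 h2
        exact absurd hact hl
      · exact le_rfl
    have := Submodule.smul_mem _ (-1 : ℝ) (Submodule.subset_span (R := ℝ) this)
    simpa using this
  · have : (1 : ℝ) • unitVec j ∈ criticalCone f (P.constraint A) c := by
      refine ⟨fun l hact => ?_, by simp [hj]⟩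
      rw [hconstr]
      obtain ⟨i, k, b⟩ := l
      split_ifs with h1 h2
      · simp only at h2
        subst h1 h2
        exact absurd hact hu
      · norm_num
      · exact le_rfl
    simpa using Submodule.subset_span (R := ℝ) this

/-- Stability of local minimizers for an objective that is jointly `C²`. -/
theorem stability_of_contDiffAt {f : Config n → (Fin n → ℝ) → ℝ} {A₀ : Fin n → ℝ} {c₀ : Config n}
    (hA₀ : ∀ i, 0 < A₀ i)
    (hf : ContDiffAt ℝ 2 (fun q : Config n × (Fin n → ℝ) => f q.1 q.2) (c₀, A₀))
    (hmin : IsLocalMinimizer (fun c => f c A₀) (P.constraint A₀) c₀)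
    (hreg : IsRegularPoint (P.constraint A₀) c₀)
    (hsosc : SecondOrderSufficient (fun c => f c A₀) (P.constraint A₀) c₀) :
    ∃ (U : Set (Fin n → ℝ)) (V : Set (Config n)) (cstar : (Fin n → ℝ) → Config n)
      (K : NNReal),
      IsOpen U ∧ A₀ ∈ U ∧ (∀ A ∈ U, ∀ i, 0 < A i) ∧ IsOpen V ∧ c₀ ∈ V ∧
      cstar A₀ = c₀ ∧
      (∀ A ∈ U, ∀ c : Config n,
        (c ∈ V ∧ IsLocalMinimizer (fun c' => f c' A) (P.constraint A) c) ↔ c = cstar A) ∧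
      LipschitzOnWith K cstar U := by
  set s := P.activeShift A₀ c₀ with hs
  have hs₀ : s A₀ = 0 := P.activeShift_self A₀ c₀
  have hsC := P.contDiffAt_activeShift hA₀ c₀
  set σ := P.activeSign A₀ c₀ with hσ
  have hσ1 := P.activeSign_eq_zero_or A₀ c₀
  set C := signedSet c₀ σ with hC
  set g := fderiv ℝ (fun c => f c A₀) c₀ with hg
  have hfeas := P.eventually_feasible_iff hA₀ hmin.1 hreg
  have hloc : ∀ᶠ q : Config n × (Fin n → ℝ) in 𝓝 (c₀, A₀),
      IsLocalMinimizer (fun c => f c q.2) (P.constraint q.2) q.1 ↔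
        (q.1 - s q.2 ∈ C ∧ IsLocalMinOn (fun x => f (x + s q.2) q.2) C (q.1 - s q.2)) := by
    filter_upwards [hfeas.eventually_nhds] with q hq
    have hq' : ∀ᶠ z in 𝓝 q.1, z ∈ {x | ∀ j, P.constraint q.2 j x ≤ 0} ↔ z - s q.2 ∈ C :=
      ((Continuous.prodMk_left q.2).tendsto q.1).eventually hq
    exact and_congr hq.self_of_nhds (isLocalMinOn_translate hq')
  have hmin' : IsLocalMinOn (fun x => f (x + s A₀) A₀) C c₀ := by
    have := (hloc.self_of_nhds.1 hmin).2
    simpa only [hs₀, sub_zero] using this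
  have hmin₀ : IsLocalMinOn (fun x => f x A₀) C c₀ := by
    simpa only [hs₀, add_zero] using hmin'
  have hdiff : DifferentiableAt ℝ (fun c => f c A₀) c₀ :=
    (hasFDerivAt_partialFDeriv (hf.differentiableAt two_ne_zero)).differentiableAt
  have hgσ : ∀ j, |g (unitVec j)| = σ j * g (unitVec j) := fun j =>
    abs_apply_unitVec_of_variationalInequality (fun z hz =>
      variationalInequality_of_isLocalMinOn (convex_signedSet c₀ σ) hmin₀ hdiff.hasFDerivAt
        (self_mem_signedSet c₀ σ) hz) j (hσ1 j)
  obtain ⟨κ, hκ, hgrow⟩ := exists_linear_growth hσ1 hgσ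
  -- The shift vanishes at `A₀`, so the pulled-back objective has the original gradient and Hessian
  -- in the centres there.
  set F : Config n × (Fin n → ℝ) → ℝ := fun q => f (q.1 + s q.2) q.2 with hF
  have hF0 : (fun x => F (x, A₀)) = fun c => f c A₀ := by
    funext x; simp [hF, hs₀]
  have hFC : ContDiffAt ℝ 2 F (c₀, A₀) := by
    have h1 : ContDiffAt ℝ 2 (fun q : Config n × (Fin n → ℝ) => s q.2) (c₀, A₀) :=
      ContDiffAt.comp (c₀, A₀) (f := Prod.snd) hsC contDiffAt_snd
    have h2 : ContDiffAt ℝ 2 (fun q : Config n × (Fin n → ℝ) => (q.1 + s q.2, q.2)) (c₀, A₀) :=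
      (contDiffAt_fst.add h1).prodMk contDiffAt_snd
    refine ContDiffAt.comp (c₀, A₀) (f := fun q : Config n × (Fin n → ℝ) => (q.1 + s q.2, q.2))
      (g := fun q : Config n × (Fin n → ℝ) => f q.1 q.2) ?_ h2
    simpa [hs₀] using hf
  obtain ⟨r₀, hr₀, hmain⟩ := exists_lipschitz_localMinimizer (isClosed_signedSet c₀ σ)
    (convex_signedSet c₀ σ) (self_mem_signedSet c₀ σ)
    (coordProj {j | g (unitVec j) = 0})
    (fun z => config_ext fun j => by
      classical
      rw [coordProj_coord, coordProj_coord]; split_ifs <;> rfl)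
    (fun x hx => coordProj_mem_signedSet _ hx) hFC hmin' hκ
    (by rw [hF0]; exact hgrow)
    (by
      rw [hF0]
      exact fun d hd h0 => P.pos_of_secondOrderSufficient hreg hsosc hd h0)
  obtain ⟨R, hR, hloc⟩ := Metric.eventually_nhds_iff_ball.1 hloc
  set r := min r₀ R with hr
  have hr0 : 0 < r := lt_min hr₀ hR
  obtain ⟨δ, hδ, m, K, hm₀, hmLip, hmiff⟩ := hmain r hr0 (min_le_left _ _)
  obtain ⟨Ks, T, hT, hsLip⟩ := (hsC.of_le one_le_two).exists_lipschitzOnWith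
  have hmcont : ContinuousAt m A₀ :=
    (hmLip.continuousOn.continuousAt (Metric.ball_mem_nhds _ hδ))
  have hscont : ContinuousAt s A₀ := hsC.continuousAt
  have hev : ∀ᶠ A in 𝓝 A₀, A ∈ T ∧ A ∈ Metric.ball A₀ δ ∧ A ∈ Metric.ball A₀ R ∧
      ‖s A‖ < r / 2 ∧ m A + s A ∈ Metric.ball c₀ (r / 2) ∧ ∀ i, 0 < A i := by
    have h1 : ∀ᶠ A in 𝓝 A₀, A ∈ T := hT
    have h2 : ∀ᶠ A in 𝓝 A₀, A ∈ Metric.ball A₀ δ := Metric.ball_mem_nhds _ hδ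
    have h3 : ∀ᶠ A in 𝓝 A₀, A ∈ Metric.ball A₀ R := Metric.ball_mem_nhds _ hR
    have h4 : ∀ᶠ A in 𝓝 A₀, ‖s A‖ < r / 2 :=
      hscont.norm.eventually (gt_mem_nhds (by simp only [hs₀, norm_zero]; positivity))
    have h5 : ∀ᶠ A in 𝓝 A₀, m A + s A ∈ Metric.ball c₀ (r / 2) := by
      refine (hmcont.add hscont).eventually (Metric.isOpen_ball.mem_nhds ?_)
      simp [hm₀, hs₀, hr0]
    have h6 : ∀ᶠ A in 𝓝 A₀, ∀ i, 0 < A i := eventually_all.2 fun i =>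
      (continuous_apply i).continuousAt.eventually (lt_mem_nhds (hA₀ i))
    filter_upwards [h1, h2, h3, h4, h5, h6] with A a1 a2 a3 a4 a5 a6
    exact ⟨a1, a2, a3, a4, a5, a6⟩
  obtain ⟨δ', hδ', hU⟩ := Metric.eventually_nhds_iff_ball.1 hev
  -- The minimizer on the fixed set is shifted back. The radius `r / 2` leaves room for a shift of
  -- norm below `r / 2`, so uniqueness in the ball of radius `r` applies to the unshifted point.
  refine ⟨Metric.ball A₀ δ', Metric.ball c₀ (r / 2), fun A => m A + s A, K + Ks,
    Metric.isOpen_ball, Metric.mem_ball_self hδ', fun A hA => (hU A hA).2.2.2.2.2,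
    Metric.isOpen_ball, Metric.mem_ball_self (by positivity), by simp [hm₀, hs₀],
    fun A hA c => ?_, ?_⟩
  · obtain ⟨-, hAδ, hAR, hsA, hmA, -⟩ := hU A hA
    have hiff := hmiff A hAδ
    have hmem : ∀ {c}, c ∈ Metric.ball c₀ (r / 2) → (c, A) ∈ Metric.ball (c₀, A₀) R := by
      intro c hc
      rw [← ball_prod_same]
      exact ⟨Metric.ball_subset_ball (by linarith [min_le_right r₀ R]) hc, hAR⟩
    constructor
    · rintro ⟨hcV, hcm⟩
      obtain ⟨h1, h2⟩ := (hloc _ (hmem hcV)).1 hcm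
      have h3 : c - s A ∈ Metric.ball c₀ r := by
        rw [mem_ball_iff_norm] at hcV ⊢
        have := norm_sub_le (c - c₀) (s A)
        rw [show c - s A - c₀ = c - c₀ - s A by abel]
        linarith
      exact eq_add_of_sub_eq ((hiff _).1 ⟨h3, h1, h2⟩)
    · rintro rfl
      obtain ⟨-, h1, h2⟩ := (hiff (m A)).2 rfl
      refine ⟨hmA, (hloc _ (hmem hmA)).2 ?_⟩
      simp only [add_sub_cancel_right]
      exact ⟨h1, h2⟩
  · exact (hmLip.mono fun A hA => (hU A hA).2.1).add (hsLip.mono fun A hA => (hU A hA).1)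

end Problem

/-! ### Smoothness of integrals that depend on a parameter -/

section ParametricIntegral

universe u
variable {Q F : Type u} [NormedAddCommGroup Q] [NormedSpace ℝ Q] [NormedAddCommGroup F]
  [NormedSpace ℝ F]

/-- Integration as a continuous linear functional on continuous functions. -/
def integralCLM (K F : Type*) [TopologicalSpace K] [CompactSpace K] [MeasurableSpace K]
    [BorelSpace K] [NormedAddCommGroup F] [NormedSpace ℝ F] [SecondCountableTopologyEither K F]
    (μ : Measure K) [IsFiniteMeasure μ] : C(K, F) →L[ℝ] F :=
  LinearMap.mkContinuous
    { toFun := fun f => ∫ x, f x ∂μ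
      map_add' := fun f g => integral_add (f.continuous.integrable_of_hasCompactSupport
        (HasCompactSupport.of_compactSpace _)) (g.continuous.integrable_of_hasCompactSupport
        (HasCompactSupport.of_compactSpace _))
      map_smul' := fun c f => integral_smul c f } (μ.real univ) fun f => by
    rw [mul_comm]
    exact norm_integral_le_of_norm_le_const (Eventually.of_forall fun x => f.norm_coe_le_norm x)

/-- The integral of a jointly smooth function over a compact set is smooth in the parameter. -/
theorem contDiff_setIntegral {X : Type*} [NormedAddCommGroup X] [NormedSpace ℝ X]
    [MeasurableSpace X] [BorelSpace X] [SecondCountableTopology X] (μ : Measure X)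
    [IsFiniteMeasureOnCompacts μ] {S : Set X} (hS : IsCompact S) {n : ℕ} {Φ : Q × X → F}
    (hΦ : ContDiff ℝ n Φ) : ContDiff ℝ n (fun p => ∫ x in S, Φ (p, x) ∂μ) := by
  have : CompactSpace S := isCompact_iff_compactSpace.1 hS
  have : IsFiniteMeasure (μ.comap (Subtype.val : S → X)) := by
    refine ⟨?_⟩
    rw [(MeasurableEmbedding.subtype_coe hS.measurableSet).comap_apply]
    simpa using hS.measure_lt_top
  have h := (integralCLM S F (μ.comap (Subtype.val : S → X))).contDiff.comp
    (contDiff_continuousMap (S := S) n hΦ)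
  have e : (fun p => ∫ x in S, Φ (p, x) ∂μ) = fun p => ∫ x : S, Φ (p, x) ∂(μ.comap Subtype.val) :=
    funext fun p => (integral_subtype_comap hS.measurableSet fun x => Φ (p, x)).symm
  rw [e]
  exact h

theorem contDiff_intervalIntegral {n : ℕ} {Φ : Q × ℝ → F} (hΦ : ContDiff ℝ n Φ) {a b : ℝ}
    (hab : a ≤ b) : ContDiff ℝ n (fun p => ∫ t in a..b, Φ (p, t)) := by
  simpa only [intervalIntegral.integral_of_le hab, integral_Icc_eq_integral_Ioc] using
    contDiff_setIntegral volume (isCompact_Icc (a := a) (b := b)) hΦ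

end ParametricIntegral

/-! ### Marginals and primitives along coordinate lines -/

section LineIntegrals

/-- The point with `k`-th coordinate `s` on the line through `x` parallel to the `k`-th axis. -/
def moveTo (k : Fin 2) (s : ℝ) (x : Plane) : Plane := x + (s - x k) • EuclideanSpace.single k 1

theorem moveTo_apply (k : Fin 2) (s : ℝ) (x : Plane) (j : Fin 2) :
    moveTo k s x j = if j = k then s else x j := by
  by_cases h : j = k
  · subst h; simp [moveTo]
  · simp [moveTo, h]

@[simp] theorem moveTo_same (k : Fin 2) (s : ℝ) (x : Plane) : moveTo k s x k = s := by
  simp [moveTo_apply]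

@[simp] theorem moveTo_moveTo (k : Fin 2) (s t : ℝ) (x : Plane) :
    moveTo k s (moveTo k t x) = moveTo k s x := by
  ext j; simp only [moveTo_apply]; split_ifs <;> rfl

@[simp] theorem moveTo_self (k : Fin 2) (x : Plane) : moveTo k (x k) x = x := by
  simp [moveTo]

theorem contDiff_coord (k : Fin 2) {n : ℕ∞ω} : ContDiff ℝ n (fun x : Plane => x k) :=
  contDiff_euclidean.1 contDiff_id k

theorem contDiff_moveTo (k : Fin 2) {n : ℕ∞ω} :
    ContDiff ℝ n (fun q : Plane × ℝ => moveTo k q.2 q.1) := by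
  unfold moveTo
  have : ContDiff ℝ n fun q : Plane × ℝ => q.1 k :=
    (contDiff_coord k).comp contDiff_fst
  exact contDiff_fst.add ((contDiff_snd.sub this).smul contDiff_const)

/-- The integral of `f` over the segment `0 ≤ x k ≤ ℓ` parallel to the `k`-th axis. -/
def marginal (ℓ : ℝ) (k : Fin 2) (f : Plane → ℝ) (x : Plane) : ℝ := ∫ s in 0..ℓ, f (moveTo k s x)

/-- The primitive of `f` in the direction of the `k`-th axis that vanishes for `x k = 0`. -/
def linePrimitive (k : Fin 2) (f : Plane → ℝ) (x : Plane) : ℝ := ∫ s in 0..x k, f (moveTo k s x)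

theorem contDiff_marginal {ℓ : ℝ} (hℓ : 0 ≤ ℓ) (k : Fin 2) {f : Plane → ℝ} (hf : ContDiff ℝ ∞ f) :
    ContDiff ℝ ∞ (marginal ℓ k f) :=
  contDiff_infty.2 fun n =>
    contDiff_intervalIntegral (Φ := fun q : Plane × ℝ => f (moveTo k q.2 q.1))
      ((hf.of_le (by exact_mod_cast le_top)).comp (contDiff_moveTo k)) hℓ

/-- The substitution `s = x k * t` turns the variable endpoint into a parameter of the integrand
over the fixed interval from `0` to `1`. -/
theorem contDiff_linePrimitive (k : Fin 2) {f : Plane → ℝ} (hf : ContDiff ℝ ∞ f) :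
    ContDiff ℝ ∞ (linePrimitive k f) := by
  refine contDiff_infty.2 fun n => ?_
  have h1 : ContDiff ℝ n (fun x : Plane => ∫ t in (0 : ℝ)..1, f (moveTo k (x k * t) x)) := by
    refine contDiff_intervalIntegral (Φ := fun q : Plane × ℝ => f (moveTo k (q.1 k * q.2) q.1))
      ((hf.of_le (by exact_mod_cast le_top)).comp ?_) zero_le_one
    exact (contDiff_moveTo k).comp
      (contDiff_fst.prodMk (((contDiff_coord k).comp contDiff_fst).mul contDiff_snd))
  have e : linePrimitive k f = fun x => x k * ∫ t in (0 : ℝ)..1, f (moveTo k (x k * t) x) := by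
    funext x
    have := intervalIntegral.smul_integral_comp_mul_left (a := 0) (b := 1)
      (fun s => f (moveTo k s x)) (x k)
    rw [linePrimitive]
    simpa using this.symm
  rw [e]
  exact (contDiff_coord k).mul h1

theorem continuous_comp_moveTo {k : Fin 2} {f : Plane → ℝ} (hf : Continuous f) (x : Plane) :
    Continuous fun s => f (moveTo k s x) := by
  unfold moveTo
  fun_prop

theorem fderiv_linePrimitive (k : Fin 2) {f : Plane → ℝ} (hf : ContDiff ℝ ∞ f) (x : Plane) :
    fderiv ℝ (linePrimitive k f) x (EuclideanSpace.single k 1) = f x := by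
  have h1 : HasDerivAt (fun u : ℝ => ∫ s in 0..u, f (moveTo k s x)) (f (moveTo k (x k) x)) (x k) :=
    intervalIntegral.integral_hasDerivAt_right
      ((continuous_comp_moveTo hf.continuous x).intervalIntegrable _ _)
      ((continuous_comp_moveTo hf.continuous x).stronglyMeasurableAtFilter _ _)
      (continuous_comp_moveTo hf.continuous x).continuousAt
  have hd : HasFDerivAt (linePrimitive k f) (fderiv ℝ (linePrimitive k f) x) (moveTo k (x k) x) := by
    rw [moveTo_self]
    exact ((contDiff_linePrimitive k hf).differentiable (by simp) x).hasFDerivAt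
  have hl : HasDerivAt (fun u : ℝ => moveTo k u x) (EuclideanSpace.single k 1) (x k) := by
    unfold moveTo
    simpa using (((hasDerivAt_id (x k)).sub_const (x k)).smul_const
      (EuclideanSpace.single k (1 : ℝ))).const_add x
  have h2 := hd.comp_hasDerivAt (x k) hl
  have h3 : linePrimitive k f ∘ (fun u : ℝ => moveTo k u x) =
      fun u : ℝ => ∫ s in 0..u, f (moveTo k s x) := by
    funext u
    simp [linePrimitive]
  rw [h3] at h2
  rw [h2.unique h1, moveTo_self]

/-- `f` is smooth and vanishes at distance less than `δ` from the boundary of the open box with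
side lengths `L`, and outside of it. -/
structure IsBoxTest (L : Fin 2 → ℝ) (δ : ℝ) (f : Plane → ℝ) : Prop where
  smooth : ContDiff ℝ ∞ f
  eq_zero : ∀ x k, (x k < δ ∨ L k - δ < x k) → f x = 0

variable {L : Fin 2 → ℝ} {δ : ℝ} {f : Plane → ℝ}

theorem IsBoxTest.sub {g : Plane → ℝ} (hf : IsBoxTest L δ f) (hg : IsBoxTest L δ g) :
    IsBoxTest L δ (fun x => f x - g x) :=
  ⟨hf.smooth.sub hg.smooth, fun x k h => by rw [hf.eq_zero x k h, hg.eq_zero x k h, sub_zero]⟩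

theorem IsBoxTest.marginal_eq_zero (hf : IsBoxTest L δ f) (ℓ : ℝ) (k : Fin 2) {x : Plane}
    {j : Fin 2} (hj : j ≠ k) (h : x j < δ ∨ L j - δ < x j) : marginal ℓ k f x = 0 := by
  have : ∀ s, f (moveTo k s x) = 0 := fun s => hf.eq_zero _ j (by simpa [moveTo_apply, hj] using h)
  simp [marginal, this]

/-- Near the lower face the integrand vanishes. Near the upper face the primitive already equals the
whole marginal, which is zero by assumption. In the other direction the integrand vanishes on the
whole line. The margin `δ` is thus preserved. -/
theorem IsBoxTest.linePrimitive (hδ : 0 < δ) (hf : IsBoxTest L δ f) {k : Fin 2}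
    (hm : ∀ x, marginal (L k) k f x = 0) : IsBoxTest L δ (linePrimitive k f) := by
  refine ⟨contDiff_linePrimitive k hf.smooth, fun x j h => ?_⟩
  by_cases hj : j = k
  · subst hj
    rcases h with h | h
    · refine intervalIntegral.integral_zero_ae (Eventually.of_forall fun s hs => ?_)
      refine hf.eq_zero _ j (Or.inl ?_)
      rw [moveTo_same]
      rcases mem_uIoc.1 hs with h' | h'
      · exact h'.2.trans_lt h
      · exact h'.2.trans_lt hδ
    · have h1 := hm x
      have hint := fun a b => (continuous_comp_moveTo (k := j) hf.smooth.continuous x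
        ).intervalIntegrable (μ := volume) a b
      rw [marginal, ← intervalIntegral.integral_add_adjacent_intervals (hint 0 (x j)) (hint _ _)]
        at h1
      have h2 : ∫ s in (x j)..(L j), f (moveTo j s x) = 0 := by
        refine intervalIntegral.integral_zero_ae (Eventually.of_forall fun s hs => ?_)
        refine hf.eq_zero _ j (Or.inr ?_)
        rw [moveTo_same]
        rcases mem_uIoc.1 hs with h' | h'
        · exact h.trans h'.1
        · linarith [h'.1]
      rwa [h2, add_zero] at h1
  · have : ∀ s, f (moveTo k s x) = 0 := fun s =>
      hf.eq_zero _ j (by simpa [moveTo_apply, hj] using h)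
    simp [PeF.linePrimitive, this]

end LineIntegrals

/-! ### Square-integral bounds for line integrals -/

section SquareIntegrals

/-- The open box with a corner at the origin and side lengths `L`. -/
def openBox (L : Fin 2 → ℝ) : Set Plane := {x | ∀ k, 0 < x k ∧ x k < L k}

theorem isOpen_openBox (L : Fin 2 → ℝ) : IsOpen (openBox L) := by
  have : openBox L = ⋂ k, ({x : Plane | 0 < x k} ∩ {x | x k < L k}) := by
    ext x; simp [openBox]
  rw [this]
  exact isOpen_iInter_of_finite fun k =>
    (isOpen_lt continuous_const (contDiff_coord k (n := 0)).continuous).inter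
      (isOpen_lt (contDiff_coord k (n := 0)).continuous continuous_const)

theorem isCompact_closedBox (a b : Fin 2 → ℝ) :
    IsCompact {x : Plane | ∀ k, a k ≤ x k ∧ x k ≤ b k} := by
  have h : {x : Plane | ∀ k, a k ≤ x k ∧ x k ≤ b k} =
      (EuclideanSpace.equiv (Fin 2) ℝ).symm '' Icc a b := by
    ext x
    simp only [mem_image, mem_Icc, mem_ofPred_eq]
    constructor
    · exact fun hx => ⟨EuclideanSpace.equiv (Fin 2) ℝ x, ⟨fun k => (hx k).1, fun k => (hx k).2⟩,
        by simp⟩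
    · rintro ⟨y, ⟨h1, h2⟩, rfl⟩ k
      exact ⟨h1 k, h2 k⟩
  rw [h]
  exact isCompact_Icc.image (EuclideanSpace.equiv (Fin 2) ℝ).symm.continuous

/-- Cauchy–Schwarz, read off from the nonnegativity of the integrated squared deviation from the
mean. -/
theorem sq_intervalIntegral_le {φ : ℝ → ℝ} (hφ : Continuous φ) {a b : ℝ} (hab : a < b) :
    (∫ t in a..b, φ t) ^ 2 ≤ (b - a) * ∫ t in a..b, φ t ^ 2 := by
  set I := ∫ t in a..b, φ t with hI
  have hba : 0 < b - a := sub_pos.2 hab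
  have h0 : 0 ≤ ∫ t in a..b, (φ t - I / (b - a)) ^ 2 :=
    intervalIntegral.integral_nonneg hab.le fun t _ => sq_nonneg _
  have h1 : ∫ t in a..b, (φ t - I / (b - a)) ^ 2 =
      (∫ t in a..b, φ t ^ 2) - I ^ 2 / (b - a) := by
    have e : ∀ t, (φ t - I / (b - a)) ^ 2 =
        φ t ^ 2 - (2 * (I / (b - a))) * φ t + (I / (b - a)) ^ 2 := fun t => by ring
    simp only [e]
    have hi1 : IntervalIntegrable (fun t => φ t ^ 2) volume a b :=
      Continuous.intervalIntegrable (by fun_prop) _ _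
    have hi2 : IntervalIntegrable (fun t => 2 * (I / (b - a)) * φ t) volume a b :=
      Continuous.intervalIntegrable (by fun_prop) _ _
    rw [intervalIntegral.integral_add (hi1.sub hi2) intervalIntegrable_const,
      intervalIntegral.integral_sub hi1 hi2,
      intervalIntegral.integral_const_mul,
      intervalIntegral.integral_const, ← hI, smul_eq_mul]
    field_simp
    ring
  rw [h1, sub_nonneg, div_le_iff₀ hba] at h0
  linarith

/-- Integrating along segments of length at most `ℓ` is bounded in `L²`. -/
theorem setIntegral_sq_le_of_abs_le {L : Fin 2 → ℝ} {k : Fin 2} (hL : 0 < L k) {f u : Plane → ℝ}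
    (hf : Continuous f) (hcs : HasCompactSupport f)
    (hu : ∀ x ∈ openBox L, |u x| ≤ ∫ s in 0..L k, |f (moveTo k s x)|) :
    ∫ x in openBox L, u x ^ 2 ≤ 4 * L k ^ 2 * ∫ x, f x ^ 2 := by
  set e : Plane := EuclideanSpace.single k 1 with he
  have hline : ∀ x : Plane, Continuous fun t : ℝ => f (x + t • e) := fun x => by fun_prop
  -- Enlarging the segment to length `2 * L k` makes the range of `t` independent of `x`. Fubini and
  -- translation invariance then give one factor `2 * L k`, and Cauchy–Schwarz gives the other.
  set q : Plane → ℝ := fun x => ∫ t in (-L k)..L k, f (x + t • e) ^ 2 with hq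
  have hpt : ∀ x ∈ openBox L, u x ^ 2 ≤ 2 * L k * q x := by
    intro x hx
    have h1 : ∫ s in 0..L k, |f (moveTo k s x)| = ∫ t in (-x k)..(L k - x k), |f (x + t • e)| := by
      have := intervalIntegral.integral_comp_sub_right (a := 0) (b := L k)
        (fun t => |f (x + t • e)|) (x k)
      rw [zero_sub] at this
      exact this
    have h2 : ∫ t in (-x k)..(L k - x k), |f (x + t • e)| ≤ ∫ t in (-L k)..L k, |f (x + t • e)| :=
      intervalIntegral.integral_mono_interval (by linarith [(hx k).2]) (by linarith [(hx k).2])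
        (by linarith [(hx k).1]) (Eventually.of_forall fun t => abs_nonneg _)
        ((hline x).abs.intervalIntegrable _ _)
    have h3 := sq_intervalIntegral_le (hline x).abs (show -L k < L k by linarith)
    simp only [sq_abs] at h3
    have h4 : |u x| ≤ ∫ t in (-L k)..L k, |f (x + t • e)| := by linarith [hu x hx]
    calc u x ^ 2 = |u x| ^ 2 := (sq_abs _).symm
      _ ≤ (∫ t in (-L k)..L k, |f (x + t • e)|) ^ 2 := by gcongr
      _ ≤ _ := h3
      _ = _ := by rw [hq]; ring
  have hfint : Integrable fun x => f x ^ 2 :=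
    (hf.pow 2).integrable_of_hasCompactSupport (by
      simpa only [pow_two] using hcs.mul_right (f' := f))
  have hprod : Integrable (fun z : Plane × ℝ => f (z.1 + z.2 • e) ^ 2)
      (volume.prod (volume.restrict (Ioc (-L k) (L k)))) := by
    rw [integrable_prod_iff' (by
      refine Continuous.aestronglyMeasurable ?_
      fun_prop)]
    refine ⟨Eventually.of_forall fun t => hfint.comp_add_right (t • e), ?_⟩
    have : ∀ t : ℝ, ∫ x, ‖f (x + t • e) ^ 2‖ = ∫ x, ‖f x ^ 2‖ := fun t =>
      integral_add_right_eq_self (fun x => ‖f x ^ 2‖) (t • e)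
    simp only [this]
    exact integrable_const _
  have hqint : Integrable q := by
    have := hprod.integral_prod_left
    simpa only [hq, intervalIntegral.integral_of_le (show -L k ≤ L k by linarith)] using this
  have hqval : ∫ x, q x = 2 * L k * ∫ x, f x ^ 2 := by
    have h1 : ∫ x, q x = ∫ t in Ioc (-L k) (L k), ∫ x, f (x + t • e) ^ 2 := by
      simp only [hq, intervalIntegral.integral_of_le (show -L k ≤ L k by linarith)]
      exact integral_integral_swap hprod
    have : ∀ t : ℝ, ∫ x, f (x + t • e) ^ 2 = ∫ x, f x ^ 2 := fun t =>
      integral_add_right_eq_self (fun x => f x ^ 2) (t • e)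
    simp only [this] at h1
    rw [h1, setIntegral_const, smul_eq_mul, Real.volume_real_Ioc_of_le (by linarith)]
    ring
  have hq0 : ∀ x, 0 ≤ q x := fun x =>
    intervalIntegral.integral_nonneg (by linarith) fun t _ => sq_nonneg _
  calc ∫ x in openBox L, u x ^ 2 ≤ ∫ x in openBox L, 2 * L k * q x :=
        integral_mono_of_nonneg (Eventually.of_forall fun x => sq_nonneg _)
          (hqint.const_mul _).integrableOn
          ((ae_restrict_iff' (isOpen_openBox L).measurableSet).2 (Eventually.of_forall hpt))
    _ ≤ ∫ x, 2 * L k * q x := setIntegral_le_integral (hqint.const_mul _)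
        (Eventually.of_forall fun x => by have := hq0 x; positivity)
    _ = _ := by rw [integral_const_mul, hqval]; ring

end SquareIntegrals

/-! ### Test functions as divergences -/

section Decomposition

variable {L : Fin 2 → ℝ} {δ : ℝ} {f g : Plane → ℝ}

theorem IsBoxTest.tsupport_subset (hf : IsBoxTest L δ f) :
    tsupport f ⊆ {x | ∀ k, δ ≤ x k ∧ x k ≤ L k - δ} := by
  refine closure_minimal (fun x hx k => ?_)
    (isCompact_closedBox (fun _ => δ) fun k => L k - δ).isClosed
  by_contra hcon
  rw [not_and_or, not_le, not_le] at hcon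
  exact hx (hf.eq_zero x k hcon)

theorem IsBoxTest.hasCompactSupport (hf : IsBoxTest L δ f) : HasCompactSupport f :=
  (isCompact_closedBox (fun _ => δ) fun k => L k - δ).of_isClosed_subset (isClosed_tsupport f)
    hf.tsupport_subset

theorem IsBoxTest.tsupport_subset_openBox (hδ : 0 < δ) (hf : IsBoxTest L δ f) :
    tsupport f ⊆ openBox L := fun x hx k => by
  have := hf.tsupport_subset hx k
  constructor <;> linarith [this.1, this.2]

theorem IsBoxTest.integral_sq (hδ : 0 < δ) (hf : IsBoxTest L δ f) :
    ∫ x, f x ^ 2 = ∫ x in openBox L, f x ^ 2 := by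
  refine (setIntegral_eq_integral_of_forall_compl_eq_zero fun x hx => ?_).symm
  have : x ∉ tsupport f := fun h => hx (hf.tsupport_subset_openBox hδ h)
  simp [image_eq_zero_of_notMem_tsupport this]

theorem IsBoxTest.memLp (hf : IsBoxTest L δ f) (p : ENNReal) (μ : Measure Plane)
    [IsFiniteMeasureOnCompacts μ] : MemLp f p μ :=
  hf.smooth.continuous.memLp_of_hasCompactSupport hf.hasCompactSupport

theorem IsBoxTest.setIntegral_sq_marginal_le (hδ : 0 < δ) (hf : IsBoxTest L δ f) {k : Fin 2}
    (hL : 0 < L k) :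
    ∫ x in openBox L, marginal (L k) k f x ^ 2 ≤ 4 * L k ^ 2 * ∫ x in openBox L, f x ^ 2 := by
  rw [← hf.integral_sq hδ]
  exact setIntegral_sq_le_of_abs_le hL hf.smooth.continuous hf.hasCompactSupport fun x _ =>
    intervalIntegral.abs_integral_le_integral_abs hL.le

theorem IsBoxTest.setIntegral_sq_linePrimitive_le (hδ : 0 < δ) (hf : IsBoxTest L δ f) {k : Fin 2}
    (hL : 0 < L k) :
    ∫ x in openBox L, PeF.linePrimitive k f x ^ 2 ≤ 4 * L k ^ 2 * ∫ x in openBox L, f x ^ 2 := by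
  rw [← hf.integral_sq hδ]
  refine setIntegral_sq_le_of_abs_le hL hf.smooth.continuous hf.hasCompactSupport fun x hx => ?_
  refine (intervalIntegral.abs_integral_le_integral_abs (hx k).1.le).trans ?_
  exact intervalIntegral.integral_mono_interval le_rfl (hx k).1.le (hx k).2.le
    (Eventually.of_forall fun t => abs_nonneg _)
    ((continuous_comp_moveTo hf.smooth.continuous x).abs.intervalIntegrable _ _)

theorem IsBoxTest.setIntegral_sq_sub_le (hf : IsBoxTest L δ f) (hg : IsBoxTest L δ g) :
    ∫ x in openBox L, (f x - g x) ^ 2 ≤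
      2 * (∫ x in openBox L, f x ^ 2) + 2 * ∫ x in openBox L, g x ^ 2 := by
  have hf2 := (hf.memLp 2 (volume.restrict (openBox L))).integrable_sq
  have hg2 := (hg.memLp 2 (volume.restrict (openBox L))).integrable_sq
  rw [← integral_const_mul, ← integral_const_mul,
    ← integral_add (hf2.const_mul 2) (hg2.const_mul 2)]
  refine integral_mono_of_nonneg (Eventually.of_forall fun x => sq_nonneg _)
    ((hf2.const_mul 2).add (hg2.const_mul 2)) (Eventually.of_forall fun x => ?_)
  nlinarith [sq_nonneg (f x + g x)]

/-- A smooth function of one variable of unit mass, supported in `[δ, ℓ - δ]`. -/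
structure IsUnitBump (ℓ δ : ℝ) (θ : ℝ → ℝ) : Prop where
  smooth : ContDiff ℝ ∞ θ
  nonneg : ∀ s, 0 ≤ θ s
  eq_zero : ∀ s, (s < δ ∨ ℓ - δ < s) → θ s = 0
  integral_eq_one : ∫ s in 0..ℓ, θ s = 1

theorem exists_isUnitBump {ℓ : ℝ} (hℓ : 0 < ℓ) : ∃ θ, IsUnitBump ℓ (ℓ / 4) θ := by
  let b : ContDiffBump (ℓ / 2) := ⟨ℓ / 8, ℓ / 4, by positivity, by linarith⟩
  have hz : ∀ s, (s < ℓ / 4 ∨ ℓ - ℓ / 4 < s) → b.normed volume s = 0 := by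
    intro s hs
    have : s ∉ Function.support (b.normed volume) := by
      rw [b.support_normed_eq, Metric.mem_ball, Real.dist_eq, not_lt]
      change ℓ / 4 ≤ _
      rcases hs with h | h
      · rw [abs_of_neg (by linarith)]; linarith
      · rw [abs_of_pos (by linarith)]; linarith
    simpa using this
  refine ⟨b.normed volume, b.contDiff_normed, b.nonneg_normed, hz, ?_⟩
  rw [← b.integral_normed (μ := volume), intervalIntegral.integral_of_le hℓ.le]
  refine setIntegral_eq_integral_of_forall_compl_eq_zero fun s hs => hz s ?_
  simp only [mem_Ioc, not_and_or, not_lt, not_le] at hs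
  rcases hs with h | h
  · left; linarith
  · right; linarith

theorem IsUnitBump.mono {ℓ δ δ' : ℝ} {θ : ℝ → ℝ} (h : IsUnitBump ℓ δ θ) (hδ : δ' ≤ δ) :
    IsUnitBump ℓ δ' θ :=
  ⟨h.smooth, h.nonneg, fun s hs => h.eq_zero s (hs.imp (fun h => by linarith) fun h => by linarith),
    h.integral_eq_one⟩

theorem IsUnitBump.exists_abs_le {ℓ δ : ℝ} {θ : ℝ → ℝ} (h : IsUnitBump ℓ δ θ) :
    ∃ B, ∀ s, |θ s| ≤ B := by
  have hcs : HasCompactSupport θ := by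
    refine HasCompactSupport.intro (isCompact_Icc (a := δ) (b := ℓ - δ)) fun s hs => ?_
    rw [mem_Icc, not_and_or, not_le, not_le] at hs
    exact h.eq_zero s hs
  exact h.smooth.continuous.bounded_above_of_compact_support hcs

/-- The function with the marginals of `f` in the `k`-th direction and profile `θ`. -/
def smear (ℓ : ℝ) (θ : ℝ → ℝ) (k : Fin 2) (f : Plane → ℝ) (x : Plane) : ℝ :=
  θ (x k) * marginal ℓ k f x

variable {θ : ℝ → ℝ} {k : Fin 2}

theorem IsBoxTest.smear (hL : 0 < L k) (hf : IsBoxTest L δ f) (hθ : IsUnitBump (L k) δ θ) :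
    IsBoxTest L δ (smear (L k) θ k f) := by
  refine ⟨(hθ.smooth.comp (contDiff_coord k)).mul (contDiff_marginal hL.le k hf.smooth),
    fun x j h => ?_⟩
  by_cases hj : j = k
  · subst hj; simp [PeF.smear, hθ.eq_zero _ h]
  · simp [PeF.smear, hf.marginal_eq_zero (L k) k hj h]

theorem marginal_smear (hθ : IsUnitBump (L k) δ θ) (f : Plane → ℝ) (x : Plane) :
    marginal (L k) k (smear (L k) θ k f) x = marginal (L k) k f x := by
  have h : ∀ s, marginal (L k) k f (moveTo k s x) = marginal (L k) k f x := fun s => by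
    simp [marginal]
  conv_lhs => rw [marginal]
  simp only [smear, h, moveTo_same]
  rw [intervalIntegral.integral_mul_const, hθ.integral_eq_one, one_mul]

/-- Smearing along a profile of unit mass preserves line integrals; the difference therefore meets
the condition under which `IsBoxTest.linePrimitive` yields a test function. -/
theorem IsBoxTest.marginal_sub_smear (hL : 0 < L k) (hf : IsBoxTest L δ f)
    (hθ : IsUnitBump (L k) δ θ) (x : Plane) :
    marginal (L k) k (fun x => f x - PeF.smear (L k) θ k f x) x = 0 := by
  have h : marginal (L k) k (fun x => f x - PeF.smear (L k) θ k f x) x =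
      marginal (L k) k f x - marginal (L k) k (PeF.smear (L k) θ k f) x :=
    intervalIntegral.integral_sub
      ((continuous_comp_moveTo hf.smooth.continuous x).intervalIntegrable _ _)
      ((continuous_comp_moveTo (hf.smear hL hθ).smooth.continuous x).intervalIntegrable _ _)
  rw [h, marginal_smear hθ, sub_self]

theorem IsBoxTest.setIntegral_sq_smear_le (hδ : 0 < δ) (hL : 0 < L k) (hf : IsBoxTest L δ f)
    {B : ℝ} (hB : ∀ s, |θ s| ≤ B) :
    ∫ x in openBox L, PeF.smear (L k) θ k f x ^ 2 ≤
      B ^ 2 * (4 * L k ^ 2) * ∫ x in openBox L, f x ^ 2 := by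
  have hint : IntegrableOn (fun x => marginal (L k) k f x ^ 2) (openBox L) := by
    have hc := (contDiff_marginal hL.le k hf.smooth).continuous.pow 2
    exact (hc.continuousOn.integrableOn_compact (isCompact_closedBox (fun _ => 0) L)).mono_set
      fun x hx j => ⟨(hx j).1.le, (hx j).2.le⟩
  calc ∫ x in openBox L, PeF.smear (L k) θ k f x ^ 2
      ≤ ∫ x in openBox L, B ^ 2 * marginal (L k) k f x ^ 2 := by
        refine integral_mono_of_nonneg (Eventually.of_forall fun x => sq_nonneg _)
          (hint.const_mul _) (Eventually.of_forall fun x => ?_)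
        simp only [PeF.smear, mul_pow]
        refine mul_le_mul_of_nonneg_right ?_ (sq_nonneg _)
        rw [← sq_abs]
        exact pow_le_pow_left₀ (abs_nonneg _) (hB _) 2
    _ ≤ _ := by
      rw [integral_const_mul, mul_assoc]
      exact mul_le_mul_of_nonneg_left (hf.setIntegral_sq_marginal_le hδ hL) (sq_nonneg B)

/-- Up to a multiple of a fixed function, every test function is the divergence of a vector field
of test functions, with a bound in `L²`. -/
theorem exists_divergence_decomposition (hL : ∀ k, 0 < L k) {δ₀ : ℝ} {θ : Fin 2 → ℝ → ℝ}
    (hθ : ∀ k, IsUnitBump (L k) δ₀ (θ k)) :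
    ∃ C : ℝ, 0 ≤ C ∧ ∀ δ, 0 < δ → δ ≤ δ₀ → ∀ f, IsBoxTest L δ f →
      ∃ (X : Fin 2 → Plane → ℝ) (m : ℝ), (∀ k, IsBoxTest L δ (X k)) ∧
        (∀ x, f x - m * (θ 0 (x 0) * θ 1 (x 1)) =
          ∑ k, fderiv ℝ (X k) x (EuclideanSpace.single k 1)) ∧
        ∀ k, ∫ x in openBox L, X k x ^ 2 ≤ C * ∫ x in openBox L, f x ^ 2 := by
  choose B hB using fun k => (hθ k).exists_abs_le
  set a : Fin 2 → ℝ := fun k => 4 * L k ^ 2 with ha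
  have ha0 : ∀ k, 0 ≤ a k := fun k => by positivity
  set b : Fin 2 → ℝ := fun k => B k ^ 2 * a k with hb
  have hb0 : ∀ k, 0 ≤ b k := fun k => mul_nonneg (sq_nonneg _) (ha0 k)
  -- The sum of the bounds for the two components, so that one constant serves both. Each `2 + 2 * b
  -- k` bounds a function minus its smearing, and the final `b 0` is the cost of the first smearing.
  -- Nothing depends on `δ`, since the profiles are fixed.
  refine ⟨a 0 * (2 + 2 * b 0) + a 1 * ((2 + 2 * b 1) * b 0), by
    have := ha0 0; have := ha0 1; have := hb0 0; have := hb0 1; positivity,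
    fun δ hδ hδ₀ f hf => ?_⟩
  have hθ' : ∀ k, IsUnitBump (L k) δ (θ k) := fun k => (hθ k).mono hδ₀
  have key : ∀ (k : Fin 2) (f : Plane → ℝ), IsBoxTest L δ f → ∃ X, IsBoxTest L δ X ∧
      (∀ x, fderiv ℝ X x (EuclideanSpace.single k 1) = f x - smear (L k) (θ k) k f x) ∧
      ∫ x in openBox L, X x ^ 2 ≤ a k * ((2 + 2 * b k) * ∫ x in openBox L, f x ^ 2) := by
    intro k f hf
    have hs := hf.smear (hL k) (hθ' k)
    have hsub := hf.sub hs
    refine ⟨linePrimitive k (fun x => f x - smear (L k) (θ k) k f x),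
      hsub.linePrimitive hδ (hf.marginal_sub_smear (hL k) (hθ' k)),
      fderiv_linePrimitive k hsub.smooth, ?_⟩
    refine (hsub.setIntegral_sq_linePrimitive_le hδ (hL k)).trans
      (mul_le_mul_of_nonneg_left ?_ (ha0 k))
    have h1 := hf.setIntegral_sq_sub_le hs
    have h2 := hf.setIntegral_sq_smear_le hδ (hL k) (hB k)
    rw [show B k ^ 2 * (4 * L k ^ 2) = b k from rfl] at h2
    linarith
  have hs := hf.smear (hL 0) (hθ' 0)
  obtain ⟨X₀, hX₀, hd₀, hn₀⟩ := key 0 f hf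
  -- Applied to the smearing of `f` rather than to `f`: the two differences telescope and leave only
  -- the function smeared in both directions, a multiple of the product profile.
  obtain ⟨X₁, hX₁, hd₁, hn₁⟩ := key 1 _ hs
  have hsq : 0 ≤ ∫ x in openBox L, f x ^ 2 := integral_nonneg fun x => sq_nonneg _
  have h2 := hf.setIntegral_sq_smear_le hδ (hL 0) (hB 0)
  rw [show B 0 ^ 2 * (4 * L 0 ^ 2) = b 0 from rfl] at h2
  refine ⟨![X₀, X₁], ∫ s in 0..L 1, marginal (L 0) 0 f (moveTo 1 s 0), ?_, fun x => ?_, ?_⟩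
  · intro k; fin_cases k
    · exact hX₀
    · exact hX₁
  · rw [Fin.sum_univ_two]
    simp only [Matrix.cons_val_zero, Matrix.cons_val_one]
    rw [hd₀, hd₁]
    have hm : ∀ s, marginal (L 0) 0 f (moveTo 1 s x) = marginal (L 0) 0 f (moveTo 1 s 0) := by
      intro s
      unfold marginal
      refine intervalIntegral.integral_congr fun t _ => congrArg f ?_
      ext j
      fin_cases j <;> simp [moveTo_apply]
    have h3 : smear (L 1) (θ 1) 1 (smear (L 0) (θ 0) 0 f) x =
        θ 1 (x 1) * (θ 0 (x 0) * ∫ s in 0..L 1, marginal (L 0) 0 f (moveTo 1 s 0)) := by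
      conv_lhs => rw [smear, marginal]
      simp only [smear, hm]
      simp [moveTo_apply]
    rw [h3]
    ring
  · intro k
    have p1 : 0 ≤ a 0 * (2 + 2 * b 0) := by have := ha0 0; have := hb0 0; positivity
    have p2 : 0 ≤ a 1 * ((2 + 2 * b 1) * b 0) := by
      have := ha0 1; have := hb0 0; have := hb0 1; positivity
    fin_cases k
    · refine hn₀.trans ?_
      have := mul_nonneg p2 hsq
      linarith
    · refine (hn₁.trans (mul_le_mul_of_nonneg_left (mul_le_mul_of_nonneg_left h2
        (by have := hb0 1; positivity)) (ha0 1))).trans ?_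
      have := mul_nonneg p1 hsq
      linarith

end Decomposition

/-! ### Mean-zero `H¹` as a closed subspace of a Hilbert space -/

section Sobolev

variable (L : Fin 2 → ℝ)

/-- Lebesgue measure on the open box. -/
def boxMeasure : Measure Plane := volume.restrict (openBox L)

instance : IsFiniteMeasure (boxMeasure L) := by
  refine isFiniteMeasure_restrict.2 (ne_of_lt ?_)
  exact (measure_mono fun x hx k => ⟨(hx k).1.le, (hx k).2.le⟩).trans_lt
    (isCompact_closedBox (fun _ => 0) L).measure_lt_top

/-- The smooth functions with compact support in the open box. -/
structure IsTestFunction (ζ : Plane → ℝ) : Prop where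
  smooth : ContDiff ℝ ∞ ζ
  compact : HasCompactSupport ζ
  subset : tsupport ζ ⊆ openBox L

variable {L}

theorem norm_toLp_sq {α E : Type*} [MeasurableSpace α] [NormedAddCommGroup E]
    [InnerProductSpace ℝ E] {μ : Measure α} {f : α → E} (hf : MemLp f 2 μ) :
    ‖hf.toLp f‖ ^ 2 = ∫ x, ‖f x‖ ^ 2 ∂μ := by
  rw [← real_inner_self_eq_norm_sq, L2.inner_def]
  refine integral_congr_ae ?_
  filter_upwards [hf.coeFn_toLp] with x hx
  rw [hx, real_inner_self_eq_norm_sq]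

theorem inner_toLp_left {α E : Type*} [MeasurableSpace α] [NormedAddCommGroup E]
    [InnerProductSpace ℝ E] {μ : Measure α} {f : α → E} (hf : MemLp f 2 μ) (g : Lp E 2 μ) :
    inner ℝ (hf.toLp f) g = ∫ x, inner ℝ (f x) (g x) ∂μ := by
  rw [L2.inner_def]
  refine integral_congr_ae ?_
  filter_upwards [hf.coeFn_toLp] with x hx
  rw [hx]

theorem inner_toLp_right {α E : Type*} [MeasurableSpace α] [NormedAddCommGroup E]
    [InnerProductSpace ℝ E] {μ : Measure α} {f : α → E} (hf : MemLp f 2 μ) (g : Lp E 2 μ) :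
    inner ℝ g (hf.toLp f) = ∫ x, inner ℝ (g x) (f x) ∂μ := by
  rw [L2.inner_def]
  refine integral_congr_ae ?_
  filter_upwards [hf.coeFn_toLp] with x hx
  rw [hx]

theorem IsBoxTest.isTestFunction {δ : ℝ} {f : Plane → ℝ} (hδ : 0 < δ) (hf : IsBoxTest L δ f) :
    IsTestFunction L f :=
  ⟨hf.smooth, hf.hasCompactSupport, hf.tsupport_subset_openBox hδ⟩

theorem IsTestFunction.exists_isBoxTest {f : Plane → ℝ} (hf : IsTestFunction L f) {δ₀ : ℝ}
    (hδ₀ : 0 < δ₀) : ∃ δ, 0 < δ ∧ δ ≤ δ₀ ∧ IsBoxTest L δ f := by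
  have hK : IsCompact (tsupport f) := hf.compact
  obtain ⟨ε, hε, hle⟩ := hK.exists_forall_le' (f := fun x : Plane =>
      min (min (x 0) (L 0 - x 0)) (min (x 1) (L 1 - x 1))) (by fun_prop) (a := 0)
    (fun x hx => by
      have h0 := hf.subset hx 0
      have h1 := hf.subset hx 1
      simp only [lt_min_iff, sub_pos]
      exact ⟨h0, h1⟩)
  refine ⟨min ε δ₀, lt_min hε hδ₀, min_le_right _ _, hf.smooth, fun x k hx => ?_⟩
  by_contra hne
  have := hle x (subset_tsupport f hne)
  simp only [le_min_iff] at this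
  have hm := min_le_left ε δ₀
  rcases hx with hx | hx <;> fin_cases k <;> simp at hx <;>
    rcases this with ⟨⟨_, _⟩, _, _⟩ <;> linarith

theorem IsTestFunction.memLp {f : Plane → ℝ} (hf : IsTestFunction L f) :
    MemLp f 2 (boxMeasure L) :=
  (hf.smooth.continuous.memLp_of_hasCompactSupport (μ := volume) hf.compact).restrict _

theorem IsTestFunction.memLp_smul {f : Plane → ℝ} (hf : IsTestFunction L f) (k : Fin 2) :
    MemLp (fun x => f x • (EuclideanSpace.single k 1 : Plane)) 2 (boxMeasure L) := by
  refine (Continuous.memLp_of_hasCompactSupport (μ := volume) (p := 2) ?_ ?_).restrict _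
  · exact hf.smooth.continuous.smul continuous_const
  · exact hf.compact.smul_right

theorem IsTestFunction.memLp_fderiv {f : Plane → ℝ} (hf : IsTestFunction L f) (k : Fin 2) :
    MemLp (fun x => fderiv ℝ f x (EuclideanSpace.single k 1)) 2 (boxMeasure L) := by
  refine (Continuous.memLp_of_hasCompactSupport (μ := volume) (p := 2) ?_ ?_).restrict _
  · exact (hf.smooth.continuous_fderiv (by simp)).clm_apply continuous_const
  · exact hf.compact.fderiv_apply ℝ _

theorem IsTestFunction.integral_fderiv_eq_zero {f : Plane → ℝ} (hf : IsTestFunction L f)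
    (k : Fin 2) : ∫ x, fderiv ℝ f x (EuclideanSpace.single k 1) ∂(boxMeasure L) = 0 := by
  have hcs := hf.compact.fderiv_apply ℝ (EuclideanSpace.single k (1 : ℝ))
  have hc : Continuous fun x => fderiv ℝ f x (EuclideanSpace.single k 1) :=
    (hf.smooth.continuous_fderiv (by simp)).clm_apply continuous_const
  have h1 : ∫ x, fderiv ℝ f x (EuclideanSpace.single k 1) ∂(boxMeasure L) =
      ∫ x, fderiv ℝ f x (EuclideanSpace.single k 1) := by
    refine setIntegral_eq_integral_of_forall_compl_eq_zero fun x hx => ?_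
    have : x ∉ tsupport (fderiv ℝ f) := fun h => hx (hf.subset (tsupport_fderiv_subset ℝ h))
    rw [image_eq_zero_of_notMem_tsupport this]
    rfl
  rw [h1]
  have := integral_mul_fderiv_eq_neg_fderiv_mul_of_integrable (𝕜 := ℝ) (μ := (volume : Measure Plane))
    (f := fun _ : Plane => (1 : ℝ)) (g := f) (v := EuclideanSpace.single k 1)
    (by simp) (by simpa using hc.integrable_of_hasCompactSupport hcs)
    (by simpa using hf.smooth.continuous.integrable_of_hasCompactSupport hf.compact)
    (by fun_prop) (fun x _ => hf.smooth.differentiable (by simp) x)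
  simpa using this

variable (L) in
/-- The space `L²` of functions on the box. -/
abbrev BoxL2 := Lp ℝ 2 (boxMeasure L)

variable (L) in
/-- The space `L²` of vector fields on the box. -/
abbrev BoxField := Lp Plane 2 (boxMeasure L)

variable (L) in
/-- The constant function `1`. -/
def oneL2 : BoxL2 L := (memLp_const (1 : ℝ)).toLp

variable (L) in
/-- Pairs whose orthogonal complement consists of the `H¹` functions of mean zero, each paired
with its weak gradient. -/
def annihilators : Set (WithLp 2 (BoxL2 L × BoxField L)) :=
  {u | ∃ (ζ : Plane → ℝ) (hζ : IsTestFunction L ζ) (k : Fin 2),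
    u = WithLp.toLp 2 ((hζ.memLp_fderiv k).toLp, (hζ.memLp_smul k).toLp)} ∪
  {WithLp.toLp 2 (oneL2 L, 0)}

variable (L) in
/-- The `H¹` functions of mean zero, each paired with its weak gradient. -/
def sobolev : Submodule ℝ (WithLp 2 (BoxL2 L × BoxField L)) :=
  (Submodule.span ℝ (annihilators L))ᗮ

theorem mem_sobolev_iff {u : WithLp 2 (BoxL2 L × BoxField L)} :
    u ∈ sobolev L ↔ ∀ a ∈ annihilators L, inner ℝ a u = 0 := by
  constructor
  · exact fun h a ha => (Submodule.mem_orthogonal _ _).1 h a (Submodule.subset_span ha)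
  · intro h
    refine (Submodule.mem_orthogonal' _ _).2 fun a ha => ?_
    have : Submodule.span ℝ (annihilators L) ≤ (innerSL ℝ u).ker :=
      Submodule.span_le.2 fun a ha => by
        simpa [real_inner_comm] using h a ha
    simpa using this ha

theorem inner_single_right (a : Plane) (t : ℝ) (k : Fin 2) :
    inner ℝ a (t • (EuclideanSpace.single k 1 : Plane)) = a k * t := by
  rw [inner_smul_right, EuclideanSpace.inner_single_right]
  simp [mul_comm]

theorem inner_oneL2 (v : BoxL2 L) : inner ℝ (oneL2 L) v = ∫ x, v x ∂(boxMeasure L) := by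
  rw [oneL2, inner_toLp_left]
  simp

/-- Orthogonality to the derivative pairs is the weak-gradient identity, and orthogonality to the
constant is the mean-zero condition. Defining the space as an orthogonal complement makes it closed,
hence complete. -/
theorem mem_sobolev_iff_weak {u : WithLp 2 (BoxL2 L × BoxField L)} :
    u ∈ sobolev L ↔ (∀ ζ, IsTestFunction L ζ → ∀ k : Fin 2,
      ∫ x, u.fst x * fderiv ℝ ζ x (EuclideanSpace.single k 1) ∂(boxMeasure L) =
        -∫ x, u.snd x k * ζ x ∂(boxMeasure L)) ∧ ∫ x, u.fst x ∂(boxMeasure L) = 0 := by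
  have h1 : ∀ ζ (hζ : IsTestFunction L ζ) (k : Fin 2),
      inner ℝ (WithLp.toLp 2 ((hζ.memLp_fderiv k).toLp, (hζ.memLp_smul k).toLp)) u =
      (∫ x, u.fst x * fderiv ℝ ζ x (EuclideanSpace.single k 1) ∂(boxMeasure L)) +
        ∫ x, u.snd x k * ζ x ∂(boxMeasure L) := by
    intro ζ hζ k
    rw [WithLp.prod_inner_apply]
    congr 1
    · change inner ℝ (MemLp.toLp _ (hζ.memLp_fderiv k)) u.fst = _
      rw [inner_toLp_left]
      simp
    · change inner ℝ (MemLp.toLp _ (hζ.memLp_smul k)) u.snd = _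
      rw [real_inner_comm, inner_toLp_right]
      simp only [inner_single_right]
  have h2 : inner ℝ (WithLp.toLp 2 (oneL2 L, (0 : BoxField L))) u =
      ∫ x, u.fst x ∂(boxMeasure L) := by
    rw [WithLp.prod_inner_apply, ← inner_oneL2]
    simp
  rw [mem_sobolev_iff]
  constructor
  · refine fun h => ⟨fun ζ hζ k => ?_, ?_⟩
    · have := h _ (Or.inl ⟨ζ, hζ, k, rfl⟩)
      rw [h1 ζ hζ k] at this
      linarith
    · rw [← h2]
      exact h _ (Or.inr rfl)
  · rintro ⟨ha, hb⟩ a (⟨ζ, hζ, k, rfl⟩ | rfl)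
    · rw [h1 ζ hζ k, ha ζ hζ k, neg_add_cancel]
    · rw [h2, hb]

theorem isH1_of_mem_sobolev {u : WithLp 2 (BoxL2 L × BoxField L)} (hu : u ∈ sobolev L) :
    IsH1 (openBox L) u.fst u.snd :=
  ⟨Lp.memLp _, Lp.memLp _, fun ζ h1 h2 h3 k => (mem_sobolev_iff_weak.1 hu).1 ζ ⟨h1, h2, h3⟩ k⟩

theorem toLp_mem_sobolev {v : Plane → ℝ} {g : Plane → Plane} (h : IsH1 (openBox L) v g)
    (h0 : ∫ x in openBox L, v x = 0) :
    (WithLp.toLp 2 (MemLp.toLp v h.memLp, MemLp.toLp g h.memLp_grad) :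
      WithLp 2 (BoxL2 L × BoxField L)) ∈ sobolev L := by
  have hv := h.memLp.coeFn_toLp
  have hg := h.memLp_grad.coeFn_toLp
  refine mem_sobolev_iff_weak.2 ⟨fun ζ hζ k => ?_, ?_⟩
  · have e1 : ∫ x, MemLp.toLp v h.memLp x * fderiv ℝ ζ x (EuclideanSpace.single k 1) ∂(boxMeasure L)
        = ∫ x in openBox L, v x * fderiv ℝ ζ x (EuclideanSpace.single k 1) :=
      integral_congr_ae (by filter_upwards [hv] with x hx; rw [hx])
    have e2 : ∫ x, MemLp.toLp g h.memLp_grad x k * ζ x ∂(boxMeasure L)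
        = ∫ x in openBox L, g x k * ζ x :=
      integral_congr_ae (by filter_upwards [hg] with x hx; rw [hx])
    exact e1.trans ((h.weakGradient ζ hζ.smooth hζ.compact hζ.subset k).trans (congrArg Neg.neg e2).symm)
  · exact (integral_congr_ae hv).trans h0

/-- A function in `L²` is bounded in norm if its pairings with test functions are. -/
theorem norm_le_of_abs_inner_test_le {u : BoxL2 L} {M : ℝ} (hM : 0 ≤ M)
    (h : ∀ f (hf : IsTestFunction L f), |inner ℝ u (hf.memLp.toLp f)| ≤ M * ‖hf.memLp.toLp f‖) :
    ‖u‖ ≤ M := by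
  set D : Submodule ℝ (BoxL2 L) :=
    Submodule.span ℝ {F | ∃ f, ∃ hf : IsTestFunction L f, F = hf.memLp.toLp f} with hD
  have hmem : ∀ F ∈ D, ∃ f, ∃ hf : IsTestFunction L f, F = hf.memLp.toLp f := by
    intro F hF
    induction hF using Submodule.span_induction with
    | mem F h => exact h
    | zero =>
      refine ⟨0, ⟨contDiff_const, HasCompactSupport.zero, by simp [tsupport]⟩, ?_⟩
      exact (MemLp.toLp_zero _).symm
    | add F G _ _ hF hG =>
      obtain ⟨f, hf, rfl⟩ := hF
      obtain ⟨g, hg, rfl⟩ := hG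
      refine ⟨f + g, ⟨hf.smooth.add hg.smooth, hf.compact.add hg.compact,
        (tsupport_add f g).trans (union_subset hf.subset hg.subset)⟩, ?_⟩
      exact (MemLp.toLp_add _ _).symm
    | smul c F _ hF =>
      obtain ⟨f, hf, rfl⟩ := hF
      refine ⟨c • f, ⟨contDiff_const.smul hf.smooth, hf.compact.smul_left,
        (closure_mono (Function.support_const_smul_subset c f)).trans hf.subset⟩, ?_⟩
      exact (MemLp.toLp_const_smul _ _).symm
  -- By the fundamental lemma of the calculus of variations the test functions are dense, so the
  -- bound extends to all of `L²` and can be applied to `u` itself.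
  have hperp : Dᗮ = ⊥ := by
    rw [eq_bot_iff]
    intro w hw
    have h0 : ∀ f, IsTestFunction L f → ∫ x, f x • w x ∂(boxMeasure L) = 0 := by
      intro f hf
      have := (Submodule.mem_orthogonal D w).1 hw _ (Submodule.subset_span ⟨f, hf, rfl⟩)
      rw [inner_toLp_left] at this
      simpa [mul_comm] using this
    have hae := (isOpen_openBox L).ae_eq_zero_of_integral_contDiff_smul_eq_zero
      (μ := boxMeasure L) (f := w)
      (((Lp.memLp w).integrable (by norm_num)).locallyIntegrable.locallyIntegrableOn _)
      fun f h1 h2 h3 => h0 f ⟨h1, h2, h3⟩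
    have hin : ∀ᵐ x ∂(boxMeasure L), x ∈ openBox L :=
      ae_restrict_mem (isOpen_openBox L).measurableSet
    refine (Lp.eq_zero_iff_ae_eq_zero).2 ?_
    filter_upwards [hae, hin] with x h1 h2
    exact h1 h2
  have hdense : Dense (D : Set (BoxL2 L)) := by
    rw [Submodule.dense_iff_topologicalClosure_eq_top, Submodule.topologicalClosure_eq_top_iff]
    exact hperp
  have hall : ∀ F : BoxL2 L, |inner ℝ u F| ≤ M * ‖F‖ := by
    intro F
    refine hdense.induction (P := fun F => |inner ℝ u F| ≤ M * ‖F‖) ?_ ?_ F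
    · intro F hF
      obtain ⟨f, hf, rfl⟩ := hmem F hF
      exact h f hf
    · exact isClosed_le (by fun_prop) (by fun_prop)
  have := hall u
  rw [real_inner_self_eq_norm_sq, abs_of_nonneg (sq_nonneg _)] at this
  rcases (norm_nonneg u).eq_or_lt with h0 | h0
  · rwa [← h0]
  · nlinarith

end Sobolev

/-! ### Poincaré inequality and the Neumann solution operator -/

section Neumann

variable {L : Fin 2 → ℝ}

theorem isBoxTest_tensor {δ : ℝ} {θ : Fin 2 → ℝ → ℝ} (hθ : ∀ k, IsUnitBump (L k) δ (θ k)) :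
    IsBoxTest L δ (fun x => θ 0 (x 0) * θ 1 (x 1)) := by
  refine ⟨((hθ 0).smooth.comp (contDiff_coord 0)).mul ((hθ 1).smooth.comp (contDiff_coord 1)),
    fun x k h => ?_⟩
  fin_cases k
  · exact mul_eq_zero_of_left ((hθ 0).eq_zero _ h) _
  · exact mul_eq_zero_of_right _ ((hθ 1).eq_zero _ h)

theorem IsUnitBump.exists_ne_zero {ℓ δ : ℝ} {θ : ℝ → ℝ} (h : IsUnitBump ℓ δ θ) :
    ∃ s, θ s ≠ 0 := by
  by_contra! hcon
  have := h.integral_eq_one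
  simp [hcon] at this

theorem setIntegral_tensor_pos {δ : ℝ} (hδ : 0 < δ) {θ : Fin 2 → ℝ → ℝ}
    (hθ : ∀ k, IsUnitBump (L k) δ (θ k)) :
    0 < ∫ x, θ 0 (x 0) * θ 1 (x 1) ∂(boxMeasure L) := by
  have ht := isBoxTest_tensor hθ
  obtain ⟨s, hs⟩ := (hθ 0).exists_ne_zero
  obtain ⟨t, ht'⟩ := (hθ 1).exists_ne_zero
  have h1 := ht.smooth.continuous.integral_pos_of_hasCompactSupport_nonneg_nonzero
    (μ := (volume : Measure Plane)) ht.hasCompactSupport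
    (fun x => mul_nonneg ((hθ 0).nonneg _) ((hθ 1).nonneg _)) (x := !₂[s, t])
    (by simpa using ⟨hs, ht'⟩)
  have h2 : ∫ x, θ 0 (x 0) * θ 1 (x 1) ∂(boxMeasure L) = ∫ x : Plane, θ 0 (x 0) * θ 1 (x 1) := by
    refine setIntegral_eq_integral_of_forall_compl_eq_zero fun x hx => ?_
    by_contra hne
    exact hx ((ht.isTestFunction hδ).subset (subset_tsupport _ hne))
  rwa [h2]

/-- The Poincaré inequality on the box. -/
theorem exists_poincare (hL : ∀ k, 0 < L k) :
    ∃ C : ℝ, 0 ≤ C ∧ ∀ u ∈ sobolev L, ‖u.fst‖ ≤ C * ‖u.snd‖ := by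
  obtain ⟨δ, hδ, θ, hθ⟩ : ∃ δ > 0, ∃ θ : Fin 2 → ℝ → ℝ, ∀ k, IsUnitBump (L k) δ (θ k) := by
    choose θ hθ using fun k => exists_isUnitBump (hL k)
    exact ⟨min (L 0 / 4) (L 1 / 4), lt_min (by linarith [hL 0]) (by linarith [hL 1]), θ,
      Fin.forall_fin_two.2 ⟨(hθ 0).mono (min_le_left _ _), (hθ 1).mono (min_le_right _ _)⟩⟩
  obtain ⟨C, hC, hdec⟩ := exists_divergence_decomposition hL hθ
  have hT := (isBoxTest_tensor hθ).isTestFunction hδ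
  have hTpos := setIntegral_tensor_pos hδ hθ
  set Θ : Plane → ℝ := fun x => θ 0 (x 0) * θ 1 (x 1) with hΘ
  refine ⟨2 * √C, by positivity, fun u hu => ?_⟩
  obtain ⟨hweak, hmean⟩ := mem_sobolev_iff_weak.1 hu
  set v := u.fst
  set g := u.snd
  set TΘ := hT.memLp.toLp with hTΘ
  have hone : inner ℝ (oneL2 L) TΘ = ∫ x, Θ x ∂(boxMeasure L) := by
    rw [hTΘ, inner_toLp_right, oneL2]
    refine integral_congr_ae ?_
    filter_upwards [(memLp_const (1 : ℝ) (μ := boxMeasure L) (p := 2)).coeFn_toLp] with x hx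
    rw [hx]; simp
  -- Subtracting this constant makes `w` orthogonal to the fixed bump, so the uncontrolled multiple
  -- `m` in the decomposition drops out. As `v` has mean zero, Pythagoras gives `‖v‖ ≤ ‖w‖`.
  set c := inner ℝ v TΘ / inner ℝ (oneL2 L) TΘ with hc
  set w := v - c • oneL2 L with hw
  have hwΘ : inner ℝ w TΘ = 0 := by
    rw [hw, inner_sub_left, real_inner_smul_left, hc, div_mul_cancel₀, sub_self]
    rw [hone]; exact hTpos.ne'
  have hvw : ‖v‖ ≤ ‖w‖ := by
    have h0 : inner ℝ v (oneL2 L) = 0 := by rw [real_inner_comm, inner_oneL2, hmean]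
    have h1 : ‖w‖ ^ 2 = ‖v‖ ^ 2 + ‖c • oneL2 L‖ ^ 2 := by
      rw [hw, @norm_sub_sq_real, real_inner_smul_right, h0]; ring
    exact le_of_sq_le_sq (by linarith [sq_nonneg ‖c • oneL2 L‖]) (norm_nonneg w)
  refine hvw.trans (norm_le_of_abs_inner_test_le (by positivity) fun f hf => ?_)
  obtain ⟨δ', hδ', hle, hbox⟩ := hf.exists_isBoxTest hδ
  obtain ⟨X, m, hX, hdiv, hXn⟩ := hdec δ' hδ' hle f hbox
  have hXt : ∀ k, IsTestFunction L (X k) := fun k => (hX k).isTestFunction hδ'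
  -- The constant does not contribute, because derivatives of test functions integrate to zero; what
  -- remains is the weak-gradient identity for `v`.
  have hpair : ∀ k, inner ℝ w ((hXt k).memLp_fderiv k).toLp =
      -inner ℝ g ((hXt k).memLp_smul k).toLp := by
    intro k
    have h1 : inner ℝ (oneL2 L) ((hXt k).memLp_fderiv k).toLp = 0 := by
      rw [real_inner_comm, inner_toLp_left, ← (hXt k).integral_fderiv_eq_zero k, oneL2]
      refine integral_congr_ae ?_
      filter_upwards [(memLp_const (1 : ℝ) (μ := boxMeasure L) (p := 2)).coeFn_toLp] with x hx
      rw [hx]; simp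
    rw [hw, inner_sub_left, real_inner_smul_left, h1, mul_zero, sub_zero, inner_toLp_right,
      inner_toLp_right]
    simp only [inner_single_right]
    rw [← hweak _ (hXt k) k]
    simp [mul_comm, v]
  have hXnorm : ∀ k, ‖((hXt k).memLp_smul k).toLp‖ ≤ √C * ‖hf.memLp.toLp‖ := by
    intro k
    refine le_of_sq_le_sq ?_ (by positivity)
    rw [mul_pow, Real.sq_sqrt hC, norm_toLp_sq, norm_toLp_sq]
    simpa [norm_smul, boxMeasure] using hXn k
  have hsum : hf.memLp.toLp = m • TΘ + ∑ k, ((hXt k).memLp_fderiv k).toLp := by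
    rw [Fin.sum_univ_two]
    refine Lp.ext ?_
    filter_upwards [hf.memLp.coeFn_toLp, hT.memLp.coeFn_toLp, ((hXt 0).memLp_fderiv 0).coeFn_toLp,
      ((hXt 1).memLp_fderiv 1).coeFn_toLp,
      Lp.coeFn_add (m • TΘ) (((hXt 0).memLp_fderiv 0).toLp + ((hXt 1).memLp_fderiv 1).toLp),
      Lp.coeFn_add ((hXt 0).memLp_fderiv 0).toLp ((hXt 1).memLp_fderiv 1).toLp,
      Lp.coeFn_smul m TΘ] with x a1 a2 a3 a4 a5 a6 a7
    have := hdiv x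
    rw [Fin.sum_univ_two] at this
    rw [a5, Pi.add_apply, a6, Pi.add_apply, a7, Pi.smul_apply, a1, a2, a3, a4, ← this, smul_eq_mul]
    ring
  rw [hsum, inner_add_right, real_inner_smul_right, hwΘ, mul_zero, zero_add, inner_sum,
    ← hsum, Fin.sum_univ_two, hpair, hpair]
  have hb : ∀ k, |inner ℝ g ((hXt k).memLp_smul k).toLp| ≤ ‖g‖ * (√C * ‖hf.memLp.toLp‖) := fun k =>
    (abs_real_inner_le_norm _ _).trans (mul_le_mul_of_nonneg_left (hXnorm k) (norm_nonneg _))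
  refine (abs_add_le _ _).trans ?_
  rw [abs_neg, abs_neg]
  have h0 := hb 0
  have h1 := hb 1
  linarith

variable (L) in
/-- The function of an element of the Sobolev space. -/
def sobolevFst : sobolev L →L[ℝ] BoxL2 L :=
  (WithLp.fstL 2 ℝ (BoxL2 L) (BoxField L)).comp (sobolev L).subtypeL

variable (L) in
/-- The gradient of an element of the Sobolev space. -/
def sobolevGrad : sobolev L →L[ℝ] BoxField L :=
  (WithLp.sndL 2 ℝ (BoxL2 L) (BoxField L)).comp (sobolev L).subtypeL

variable (L) in
/-- The Dirichlet form. -/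
def dirichletForm : sobolev L →L[ℝ] sobolev L →L[ℝ] ℝ :=
  (innerSL ℝ (E := BoxField L)).bilinearComp (sobolevGrad L) (sobolevGrad L)

theorem dirichletForm_apply (u y : sobolev L) : dirichletForm L u y =
    inner ℝ (u : WithLp 2 (BoxL2 L × BoxField L)).snd (y : WithLp 2 (BoxL2 L × BoxField L)).snd :=
  rfl

/-- The full norm contains the function as well as the gradient; Poincaré bounds its square by `C ^
2 + 1` times the Dirichlet form. -/
theorem isCoercive_dirichletForm (hL : ∀ k, 0 < L k) : IsCoercive (dirichletForm L) := by
  obtain ⟨C, hC, hP⟩ := exists_poincare hL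
  refine ⟨(C ^ 2 + 1)⁻¹, by positivity, fun u => ?_⟩
  have h1 := hP u u.2
  have h2 : ‖u‖ ^ 2 = ‖(u : WithLp 2 (BoxL2 L × BoxField L)).fst‖ ^ 2 +
      ‖(u : WithLp 2 (BoxL2 L × BoxField L)).snd‖ ^ 2 := WithLp.prod_norm_sq_eq_of_L2 _
  have h3 : dirichletForm L u u = ‖(u : WithLp 2 (BoxL2 L × BoxField L)).snd‖ ^ 2 := by
    rw [dirichletForm_apply, real_inner_self_eq_norm_sq]
  have h4 := pow_le_pow_left₀ (norm_nonneg _) h1 2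
  rw [h3, mul_assoc, ← pow_two, h2, inv_mul_le_iff₀ (by positivity)]
  nlinarith

instance : CompleteSpace (sobolev L) :=
  inferInstanceAs (CompleteSpace (Submodule.span ℝ (annihilators L))ᗮ)

/-- The energy is defined through an arbitrarily chosen solution, so computing it requires the value
for every solution. -/
theorem poissonEnergy_eq_of_forall {R : Set Plane} {f : Plane → ℝ} {a : ℝ}
    (hex : ∃ p : (Plane → ℝ) × (Plane → Plane), IsNeumannSolution R f p.1 p.2)
    (h : ∀ p : (Plane → ℝ) × (Plane → Plane), IsNeumannSolution R f p.1 p.2 →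
      ∫ x in R, ‖p.2 x‖ ^ 2 = a) : poissonEnergy R f = 1 / 2 * a := by
  rw [poissonEnergy, dif_pos hex, h _ hex.choose_spec]

/-- The gradient of the Neumann solution is a bounded linear function of the source. -/
theorem exists_solutionOperator (hL : ∀ k, 0 < L k) :
    ∃ T : BoxL2 L →L[ℝ] BoxField L, ∀ (f : Plane → ℝ) (hf : MemLp f 2 (boxMeasure L)),
      poissonEnergy (openBox L) f = 1 / 2 * ‖T hf.toLp‖ ^ 2 := by
  have hco := isCoercive_dirichletForm hL
  -- Lax–Milgram: `S` represents the Dirichlet form and `R` below represents the source functional,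
  -- so the weak equation becomes `S u = R F`.
  obtain ⟨S, hS⟩ : ∃ S : sobolev L ≃L[ℝ] sobolev L, ∀ u y, inner ℝ (S u) y = dirichletForm L u y :=
    ⟨hco.continuousLinearEquivOfBilin, hco.continuousLinearEquivOfBilin_apply⟩
  obtain ⟨R, hR⟩ : ∃ R : BoxL2 L →L[ℝ] sobolev L, ∀ F y, inner ℝ (R F) y =
      inner ℝ F (y : WithLp 2 (BoxL2 L × BoxField L)).fst :=
    ⟨(sobolevFst L).adjoint, fun F y => ContinuousLinearMap.adjoint_inner_left _ _ _⟩
  refine ⟨(sobolevGrad L).comp ((S.symm : sobolev L →L[ℝ] sobolev L).comp R), fun f hf => ?_⟩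
  have hR' : ∀ y : sobolev L, inner ℝ (R hf.toLp) y =
      ∫ x, f x * (y : WithLp 2 (BoxL2 L × BoxField L)).fst x ∂(boxMeasure L) := by
    intro y
    rw [hR, inner_toLp_left]
    simp [mul_comm]
  have hlift : ∀ (v : Plane → ℝ) (g : Plane → Plane) (h : IsH1 (openBox L) v g),
      ∫ x in openBox L, v x = 0 → ∃ y : sobolev L,
        (y : WithLp 2 (BoxL2 L × BoxField L)).fst = MemLp.toLp v h.memLp ∧
        (y : WithLp 2 (BoxL2 L × BoxField L)).snd = MemLp.toLp g h.memLp_grad :=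
    fun v g h h0 => ⟨⟨_, toLp_mem_sobolev h h0⟩, rfl, rfl⟩
  have hval : ∀ p : (Plane → ℝ) × (Plane → Plane), IsNeumannSolution (openBox L) f p.1 p.2 →
      ∫ x in openBox L, ‖p.2 x‖ ^ 2 = ‖sobolevGrad L (S.symm (R hf.toLp))‖ ^ 2 := by
    rintro ⟨φ, g⟩ hp
    obtain ⟨u, -, hu⟩ := hlift φ g hp.isH1 hp.mean_zero
    have h1 : S u = R hf.toLp := by
      refine ext_inner_right ℝ fun y => ?_
      rw [hS, hR', dirichletForm_apply, hu]
      have hy := hp.weak_eq _ _ (isH1_of_mem_sobolev y.2) (mem_sobolev_iff_weak.1 y.2).2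
      refine Eq.trans ?_ hy
      exact inner_toLp_left hp.isH1.memLp_grad _
    rw [← h1, ContinuousLinearEquiv.symm_apply_apply]
    have h2 : sobolevGrad L u = (u : WithLp 2 (BoxL2 L × BoxField L)).snd := rfl
    rw [h2, hu]
    exact (norm_toLp_sq hp.isH1.memLp_grad).symm
  have hex : ∃ p : (Plane → ℝ) × (Plane → Plane), IsNeumannSolution (openBox L) f p.1 p.2 := by
    obtain ⟨u, hu⟩ := S.surjective (R hf.toLp)
    refine ⟨((u : WithLp 2 (BoxL2 L × BoxField L)).fst, (u : WithLp 2 (BoxL2 L × BoxField L)).snd),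
      isH1_of_mem_sobolev u.2, (mem_sobolev_iff_weak.1 u.2).2, fun v gv hv hv0 => ?_⟩
    obtain ⟨y, hy1, hy2⟩ := hlift v gv hv hv0
    have h1 := hR' y
    rw [← hu, hS, dirichletForm_apply, hy1, hy2] at h1
    refine ((inner_toLp_right hv.memLp_grad _).symm.trans h1).trans (integral_congr_ae ?_)
    filter_upwards [hv.memLp.coeFn_toLp] with x hx
    exact congrArg (f x * ·) hx
  exact poissonEnergy_eq_of_forall hex hval

end Neumann

/-! ### Smoothness of the mollified module in its position and dimensions -/

section MollifiedRectangle

/-- The diagonal map of the plane with entries `w` and `h`. -/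
def diagCLM (w h : ℝ) : Plane →L[ℝ] Plane :=
  LinearMap.toContinuousLinearMap
    { toFun := fun t => !₂[w * t 0, h * t 1]
      map_add' := fun s t => by ext k; fin_cases k <;> simp [mul_add]
      map_smul' := fun a t => by ext k; fin_cases k <;> simp [mul_left_comm] }

theorem diagCLM_apply (w h : ℝ) (t : Plane) : diagCLM w h t = !₂[w * t 0, h * t 1] := rfl

theorem det_diagCLM (w h : ℝ) : (diagCLM w h).det = w * h := by
  rw [ContinuousLinearMap.det,
    ← LinearMap.det_toMatrix (EuclideanSpace.basisFun (Fin 2) ℝ).toBasis, Matrix.det_fin_two]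
  simp [LinearMap.toMatrix_apply, diagCLM_apply]

theorem diagCLM_image {w h : ℝ} (hw : 0 < w) (hh : 0 < h) :
    diagCLM w h '' centeredRect 1 1 = centeredRect w h := by
  ext y
  constructor
  · rintro ⟨t, ⟨h0, h1⟩, rfl⟩
    simp only [centeredRect, diagCLM_apply, mem_ofPred_eq] at *
    simp only [Matrix.cons_val_zero, Matrix.cons_val_one, abs_mul, abs_of_pos hw,
      abs_of_pos hh]
    constructor <;> nlinarith
  · rintro ⟨h0, h1⟩
    refine ⟨!₂[y 0 / w, y 1 / h], ⟨?_, ?_⟩, ?_⟩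
    · simp only [Matrix.cons_val_zero, abs_div, abs_of_pos hw]
      rw [div_le_iff₀ hw]; linarith
    · simp only [Matrix.cons_val_one, Matrix.cons_val_fin_one, abs_div, abs_of_pos hh]
      rw [div_le_iff₀ hh]; linarith
    · rw [diagCLM_apply]
      ext k
      fin_cases k
      · simp; field_simp
      · simp; field_simp

theorem isCompact_centeredRect (w h : ℝ) : IsCompact (centeredRect w h) := by
  have : centeredRect w h =
      {x : Plane | ∀ k, ![-(w / 2), -(h / 2)] k ≤ x k ∧ x k ≤ ![w / 2, h / 2] k} := by
    ext x
    simp [centeredRect, Fin.forall_fin_two, abs_le]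
  rw [this]
  exact isCompact_closedBox _ _

/-- The mollified indicator of a rectangle, as a function of the point and of the dimensions. -/
def mollifiedRect (η : Plane → ℝ) (ε : ℝ) (p : Plane × ℝ × ℝ) : ℝ :=
  p.2.1 * p.2.2 * ∫ t in centeredRect 1 1,
    scaledMollifier η ε (p.1 - diagCLM p.2.1 p.2.2 t)

/-- The diagonal change of variables replaces a rectangle that varies with `w` and `h` by the unit
square, at the price of the determinant `w * h`. -/
theorem mollifiedIndicator_eq (η : Plane → ℝ) (ε : ℝ) {w h : ℝ} (hw : 0 < w) (hh : 0 < h)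
    (z : Plane) :
    mollifiedIndicator η ε (centeredRect w h) z = mollifiedRect η ε (z, w, h) := by
  have h1 : mollifiedIndicator η ε (centeredRect w h) z =
      ∫ y in centeredRect w h, scaledMollifier η ε (z - y) := by
    rw [mollifiedIndicator, ← integral_indicator (isCompact_centeredRect w h).measurableSet]
    refine integral_congr_ae (Eventually.of_forall fun y => ?_)
    by_cases hy : y ∈ centeredRect w h <;> simp [hy]
  have hinj : InjOn (diagCLM w h) (centeredRect 1 1) := by
    intro s _ t _ hst
    rw [diagCLM_apply, diagCLM_apply] at hst
    ext k
    have := congrArg (fun v : Plane => v k) hst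
    fin_cases k
    · simpa [hw.ne'] using this
    · simpa [hh.ne'] using this
  rw [h1, ← diagCLM_image hw hh, integral_image_eq_integral_abs_det_fderiv_smul volume
    (isCompact_centeredRect 1 1).measurableSet
    (fun x _ => (diagCLM w h).hasFDerivAt.hasFDerivWithinAt) hinj]
  simp only [det_diagCLM, abs_of_pos (mul_pos hw hh), smul_eq_mul]
  rw [integral_const_mul]
  rfl

/-- After rescaling, only the smooth mollifier depends on the parameters. The formula is smooth for
all real dimensions, so positivity matters only for its identification with the mollified indicator.
-/
theorem contDiff_mollifiedRect {η : Plane → ℝ} (hη : ContDiff ℝ ∞ η) (ε : ℝ) (n : ℕ) :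
    ContDiff ℝ n (mollifiedRect η ε) := by
  have hs : ContDiff ℝ n (scaledMollifier η ε) := by
    unfold scaledMollifier
    exact contDiff_const.mul ((hη.of_le (by exact_mod_cast le_top)).comp
      (contDiff_const_smul ε⁻¹))
  have hd : ContDiff ℝ n (fun q : (Plane × ℝ × ℝ) × Plane => diagCLM q.1.2.1 q.1.2.2 q.2) := by
    simp only [diagCLM_apply]
    refine contDiff_euclidean.2 fun k => ?_
    fin_cases k
    · exact (contDiff_fst.comp (contDiff_snd.comp contDiff_fst)).mul
        ((contDiff_coord 0).comp contDiff_snd)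
    · exact (contDiff_snd.comp (contDiff_snd.comp contDiff_fst)).mul
        ((contDiff_coord 1).comp contDiff_snd)
  have hi := contDiff_setIntegral (volume : Measure Plane) (isCompact_centeredRect 1 1)
    (Φ := fun q : (Plane × ℝ × ℝ) × Plane =>
      scaledMollifier η ε (q.1.1 - diagCLM q.1.2.1 q.1.2.2 q.2))
    (hs.comp ((contDiff_fst.comp contDiff_fst).sub hd))
  exact ((contDiff_fst.comp contDiff_snd).mul (contDiff_snd.comp contDiff_snd)).mul hi

end MollifiedRectangle

/-! ### From continuous functions on the closed box to `L²` -/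

section ContinuousToL2

variable {L : Fin 2 → ℝ}

/-- The closed box with a corner at the origin and side lengths `L`. -/
def closedBox (L : Fin 2 → ℝ) : Set Plane := {x | ∀ k, 0 ≤ x k ∧ x k ≤ L k}

instance : CompactSpace (closedBox L) :=
  isCompact_iff_compactSpace.1 (isCompact_closedBox (fun _ => 0) L)

/-- The projection to the closed box. -/
def clampBox (hL : ∀ k, 0 < L k) (x : Plane) : closedBox L :=
  ⟨WithLp.toLp 2 fun k => max 0 (min (x k) (L k)), fun k =>
    ⟨le_max_left _ _, max_le (hL k).le (min_le_right _ _)⟩⟩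

theorem continuous_clampBox (hL : ∀ k, 0 < L k) : Continuous (clampBox hL) := by
  unfold clampBox
  fun_prop

theorem clampBox_of_mem (hL : ∀ k, 0 < L k) {x : Plane} (hx : x ∈ openBox L) :
    (clampBox hL x : Plane) = x := by
  ext k
  simp [clampBox, (hx k).1.le, (hx k).2.le]

theorem memLp_comp_clampBox (hL : ∀ k, 0 < L k) (f : C(closedBox L, ℝ)) :
    MemLp (fun x => f (clampBox hL x)) 2 (boxMeasure L) :=
  MemLp.of_bound (f.continuous.comp (continuous_clampBox hL)).aestronglyMeasurable ‖f‖
    (Eventually.of_forall fun _ => f.norm_coe_le_norm _)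

/-- The map from continuous functions on the closed box to `L²`. -/
def continuousToL2 (hL : ∀ k, 0 < L k) : C(closedBox L, ℝ) →L[ℝ] BoxL2 L :=
  LinearMap.mkContinuous
    { toFun := fun f => (memLp_comp_clampBox hL f).toLp
      map_add' := fun _ _ => MemLp.toLp_add _ _
      map_smul' := fun _ _ => MemLp.toLp_const_smul _ _ }
    ((measureUnivNNReal (boxMeasure L) : ℝ) ^ (2 : ENNReal).toReal⁻¹) fun f => by
      refine Lp.norm_le_of_ae_bound (norm_nonneg f) ?_
      filter_upwards [(memLp_comp_clampBox hL f).coeFn_toLp] with x hx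
      change ‖MemLp.toLp _ (memLp_comp_clampBox hL f) x‖ ≤ _
      rw [hx]
      exact f.norm_coe_le_norm _

end ContinuousToL2

/-! ### Joint `C²` regularity of the energy and of the objective -/

namespace Problem

variable {n : ℕ} (P : Problem n)

theorem outline_pos (k : Fin 2) : 0 < P.outline k := by
  fin_cases k
  · exact P.W_pos
  · exact P.H_pos

theorem region_eq_openBox : P.region = openBox P.outline := by
  ext x
  simp [region, openBox, outline, Fin.forall_fin_two]

/-- The density as a function of the centres, the dimensions of the modules, and the point. -/
def densityOfDims (q : (Config n × (Fin n → ℝ) × (Fin n → ℝ)) × Plane) : ℝ :=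
  ∑ i, mollifiedRect P.η P.ε (q.2 - q.1.1 i, q.1.2.1 i, q.1.2.2 i)

theorem contDiff_densityOfDims (m : ℕ) : ContDiff ℝ m P.densityOfDims := by
  refine ContDiff.sum fun i _ => (contDiff_mollifiedRect P.isMollifier.smooth P.ε m).comp ?_
  refine (contDiff_snd.sub ?_).prodMk (ContDiff.prodMk ?_ ?_)
  · exact (contDiff_apply ℝ Plane i).comp (contDiff_fst.comp contDiff_fst)
  · exact (contDiff_apply ℝ ℝ i).comp (contDiff_fst.comp (contDiff_snd.comp contDiff_fst))
  · exact (contDiff_apply ℝ ℝ i).comp (contDiff_snd.comp (contDiff_snd.comp contDiff_fst))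

theorem density_eq {A : Fin n → ℝ} (hA : ∀ i, 0 < A i) (c : Config n) (x : Plane) :
    P.density c A x =
      P.densityOfDims ((c, fun i => P.w i (A i), fun i => P.h i (A i)), x) :=
  Finset.sum_congr rfl fun i _ =>
    mollifiedIndicator_eq _ _ (P.w_pos i _ (hA i)) (P.h_pos i _ (hA i)) _

/-- The density as a continuous function on the closed outline. -/
def densityMap (p : Config n × (Fin n → ℝ) × (Fin n → ℝ)) : C(closedBox P.outline, ℝ) :=
  ⟨fun x => P.densityOfDims (p, x), (P.contDiff_densityOfDims 0).continuous.comp (by fun_prop)⟩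

theorem contDiff_densityMap : ContDiff ℝ 2 P.densityMap :=
  contDiff_continuousMap 2 (P.contDiff_densityOfDims 2)

/-- The energy is a smooth function of the centres and the dimensions of the modules. -/
theorem exists_energy_eq : ∃ T : BoxL2 P.outline →L[ℝ] BoxField P.outline,
    ∀ (c : Config n) (A : Fin n → ℝ), (∀ i, 0 < A i) → P.energy c A = 1 / 2 *
      ‖T (continuousToL2 P.outline_pos
          (P.densityMap (c, fun i => P.w i (A i), fun i => P.h i (A i))) -
        P.meanDensity A • oneL2 P.outline)‖ ^ 2 := by
  obtain ⟨T, hT⟩ := exists_solutionOperator P.outline_pos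
  refine ⟨T, fun c A hA => ?_⟩
  have hmem := (memLp_comp_clampBox P.outline_pos
    (P.densityMap (c, fun i => P.w i (A i), fun i => P.h i (A i)))).sub
      ((memLp_const (1 : ℝ) (μ := boxMeasure P.outline) (p := 2)).const_smul (P.meanDensity A))
  have hae : (fun x => P.density c A x - P.meanDensity A) =ᵐ[boxMeasure P.outline]
      (fun x => P.densityMap (c, fun i => P.w i (A i), fun i => P.h i (A i))
        (clampBox P.outline_pos x)) - P.meanDensity A • fun _ => (1 : ℝ) := by
    filter_upwards [ae_restrict_mem (isOpen_openBox P.outline).measurableSet] with x hx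
    simp [densityMap, clampBox_of_mem P.outline_pos hx, P.density_eq hA]
  have hf := (memLp_congr_ae hae).2 hmem
  rw [energy, region_eq_openBox, hT _ hf, (MemLp.toLp_eq_toLp_iff hf hmem).2 hae, MemLp.toLp_sub
      (memLp_comp_clampBox P.outline_pos _) ((memLp_const (1 : ℝ)).const_smul _),
    MemLp.toLp_const_smul _ (memLp_const (1 : ℝ))]
  rfl

/-- A composition in which the dimensions as functions of the areas are the only ingredient of
limited regularity: density and mean density are smooth in their arguments, the passage to `L²` and
the solution operator are bounded and linear, and the squared norm is smooth. -/
theorem contDiffAt_energy (c : Config n) {A : Fin n → ℝ} (hA : ∀ i, 0 < A i) :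
    ContDiffAt ℝ 2 (fun q : Config n × (Fin n → ℝ) => P.energy q.1 q.2) (c, A) := by
  obtain ⟨T, hT⟩ := P.exists_energy_eq
  have hev : ∀ᶠ q : Config n × (Fin n → ℝ) in 𝓝 (c, A), ∀ i, 0 < q.2 i :=
    eventually_all.2 fun i =>
      (((continuous_apply i).comp continuous_snd).tendsto (c, A)).eventually (lt_mem_nhds (hA i))
  refine ContDiffAt.congr_of_eventuallyEq ?_ (hev.mono fun q hq => hT q.1 q.2 hq)
  have hw : ContDiffAt ℝ 2 (fun q : Config n × (Fin n → ℝ) => fun i => P.w i (q.2 i)) (c, A) :=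
    contDiffAt_pi.2 fun i => ContDiffAt.comp (c, A) (f := Prod.snd) (P.contDiffAt_width hA i)
      contDiffAt_snd
  have hh : ContDiffAt ℝ 2 (fun q : Config n × (Fin n → ℝ) => fun i => P.h i (q.2 i)) (c, A) :=
    contDiffAt_pi.2 fun i => ContDiffAt.comp (c, A) (f := Prod.snd) (P.contDiffAt_height hA i)
      contDiffAt_snd
  have hρ : ContDiffAt ℝ 2 (fun q : Config n × (Fin n → ℝ) =>
      P.densityMap (q.1, fun i => P.w i (q.2 i), fun i => P.h i (q.2 i))) (c, A) :=
    ContDiffAt.comp (c, A) P.contDiff_densityMap.contDiffAt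
      (contDiffAt_fst.prodMk (hw.prodMk hh))
  have hm : ContDiffAt ℝ 2 (fun q : Config n × (Fin n → ℝ) => P.meanDensity q.2) (c, A) := by
    unfold meanDensity
    exact ((ContDiff.sum fun i _ => (contDiff_apply ℝ ℝ i).comp contDiff_snd).div_const
      _).contDiffAt
  refine contDiffAt_const.mul (ContDiffAt.norm_sq ℝ (T.contDiff.contDiffAt.comp (c, A) ?_))
  exact ((continuousToL2 P.outline_pos).contDiff.contDiffAt.comp (c, A) hρ).sub
    (hm.smul contDiffAt_const)

theorem contDiffAt_objective (c : Config n) {A : Fin n → ℝ} (hA : ∀ i, 0 < A i) :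
    ContDiffAt ℝ 2 (fun q : Config n × (Fin n → ℝ) => P.objective q.1 q.2) (c, A) := by
  have hpos : IsOpen {A : Fin n → ℝ | ∀ i, 0 < A i} := by
    have : {A : Fin n → ℝ | ∀ i, 0 < A i} = ⋂ i, {A | 0 < A i} := by ext; simp
    rw [this]
    exact isOpen_iInter_of_finite fun i => isOpen_lt continuous_const (continuous_apply i)
  exact (P.wirelength_smooth.contDiffAt
    ((isOpen_univ.prod hpos).mem_nhds (mk_mem_prod (mem_univ c) hA))).add
    (contDiffAt_const.mul (P.contDiffAt_energy c hA))

end Problem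

end PeF

end

theorem mainTheorem12 {n : ℕ} (P : PeF.Problem n) (A₀ : Fin n → ℝ) (c₀ : PeF.Config n)
    (hA₀ : ∀ i, 0 < A₀ i)
    (hmin : PeF.IsLocalMinimizer (fun c => P.objective c A₀) (P.constraint A₀) c₀)
    (hreg : PeF.IsRegularPoint (P.constraint A₀) c₀)
    (hsosc : PeF.SecondOrderSufficient (fun c => P.objective c A₀) (P.constraint A₀) c₀) :
    ∃ (U : Set (Fin n → ℝ)) (V : Set (PeF.Config n)) (cstar : (Fin n → ℝ) → PeF.Config n)
      (K : NNReal),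
      IsOpen U ∧ A₀ ∈ U ∧ (∀ A ∈ U, ∀ i, 0 < A i) ∧ IsOpen V ∧ c₀ ∈ V ∧
      cstar A₀ = c₀ ∧
      (∀ A ∈ U, ∀ c : PeF.Config n,
        (c ∈ V ∧ PeF.IsLocalMinimizer (fun c' => P.objective c' A) (P.constraint A) c) ↔
          c = cstar A) ∧
      LipschitzOnWith K cstar U :=
  P.stability_of_contDiffAt hA₀ (P.contDiffAt_objective c₀ hA₀) hmin hreg hsosc
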